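/- Uniqueness of the driven $\eta$-condensate. Let $d\ge 1$, let $M\ge 2$ be even, let $\Lambda=(\mathbb Z/M)^d$ be the periodic hypercubic lattice with $M^d$ sites (which is bipartite), and let $0\le N\le M^d$. Let $f_{\sigma,l}$ ($\sigma\in\{\uparrow,\downarrow\}$, $l\in\Lambda$) be the fermionic annihilation operators, satisfying the canonical anticommutation relations on the fermionic Fock space over $\Lambda\times\{\uparrow,\downarrow\}$ with vacuum $|0\rangle$, put $n_{\sigma,l}=f^\dagger_{\sigma,l}f_{\sigma,l}$ and $\eta_l^\dagger=f^\dagger_{\uparrow,l}f^\dagger_{\downarrow,l}$, and let $\mathcal H_N$ be the subspace of states with $N$ spin-up and $N$ spin-down fermions. Let $S(l)=(-1)^{l_1+\dots+l_d}$, let $$\eta^\dagger=\frac1{\sqrt{M^d}}\sum_{l\in\Lambda}S(l)\,\eta_l^\dagger,\qquad |\eta,N\rangle=(\eta^\dagger)^N|0\rangle ,$$ and, for $J,U\in\mathbb R$, let $$H_{FH}=-J\sum_{(l,l'),\,\sigma}\bigl(f^\dagger_{\sigma,l}f_{\sigma,l'}+f^\dagger_{\sigma,l'}f_{\sigma,l}\bigr)+U\sum_l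 n_{\uparrow,l}n_{\downarrow,l},$$ where the first sum runs over all bonds $(l,l')=(l,l+e_\lambda)$, $l\in\Lambda$, $1\le\lambda\le d$. For every such bond consider the jump operators $$\begin{aligned} c^{(1)}_{l,\lambda}&=(\eta_l^\dagger-\eta_{l'}^\dagger)(\eta_l+\eta_{l'}),\\ c^{(2)}_{l,\lambda}&=n_{\uparrow,l}f^\dagger_{\downarrow,l}f_{\downarrow,l'}+n_{\uparrow,l'}f^\dagger_{\downarrow,l'}f_{\downarrow,l},\\ c^{(3)}_{l,\lambda}&=(f^\dagger_{\uparrow,l}+f^\dagger_{\uparrow,l'})(f_{\uparrow,l}+f_{\uparrow,l'})(1-n_{\downarrow,l})(1-n_{\downarrow,l'}),\\ c^{(4)}_{l,\lambda}&=(f^\dagger_{\downarrow,l}f_{\downarrow,l'}+f^\dagger_{\downarrow,l'}f_{\downarrow,l})\,n_{\uparrow,l}n_{\uparrow,l'}, \end{aligned}$$ with arbitrary rates $g^{(k)}_{l,\lambda}>0$, and the master equation $\dot\rho=\mathcal L(\rho)$ with $$\mathcal L(\rho)=-i[H_{FH},\rho]+\sum_{k,l,\lambda}g^{(k)}_{l,\lambda}\Bigl(2c^{(k)}_{l,\lambda}\rho\,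 c^{(k)\dagger}_{l,\lambda}-c^{(k)\dagger}_{l,\lambda}c^{(k)}_{l,\lambda}\rho-\rho\, c^{(k)\dagger}_{l,\lambda}c^{(k)}_{l,\lambda}\Bigr).$$ Then for all $J,U\in\mathbb R$ (in particular for the purely dissipative process, $J=U=0$): 1. $|\eta,N\rangle$ is a nonzero vector of $\mathcal H_N$ and $H_{FH}|\eta,N\rangle=NU\,|\eta,N\rangle$; 2. $|\eta,N\rangle$ is the unique dark state: a vector $|\Psi\rangle\in\mathcal H_N$ satisfies $c^{(k)}_{l,\lambda}|\Psi\rangle=0$ for all $k,l,\lambda$ if and only if it is a scalar multiple of $|\eta,N\rangle$; 3. $|\eta,N\rangle$ is the unique stationary state: the density operators $\rho$ on $\mathcal H_N$ with $\mathcal L(\rho)=0$ are exactly the one operator $\rho=|\eta,N\rangle\langle\eta,N|\,/\,\langle\eta,N|\eta,N\rangle$. -/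

import Mathlib

open scoped BigOperators

noncomputable section

namespace EtaCondensate

/-! Fermions on the periodic hypercubic lattice with `M ^ d` sites. -/

/-- The sites of the `d`-dimensional hypercubic lattice with `M` sites in each direction. -/
abbrev Site (d M : ℕ) : Type := Fin d → Fin M

/-- The two internal states of a fermion. -/
abbrev Spin : Type := Fin 2

/-- The internal state `↑`. -/
abbrev up : Spin := 0

/-- The internal state `↓`. -/
abbrev down : Spin := 1

/-- The single-particle modes: a site together with an internal state. -/
abbrev Mode (d M : ℕ) : Type := Site d M × Spin

/-- The fermionic Fock space over all modes. The coordinate of a vector at a finite set `S` of modes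
is its amplitude on the normalized position-basis state in which exactly the modes in `S` are
occupied. -/
abbrev Fock (d M : ℕ) : Type := EuclideanSpace ℂ (Finset (Mode d M))

/-- The position of a mode in the ordering that fixes the fermionic (Jordan–Wigner) signs. -/
def modeIndex {d M : ℕ} (m : Mode d M) : ℕ :=
  2 * (finFunctionFinEquiv m.1 : ℕ) + (m.2 : ℕ)

/-- The Jordan–Wigner sign: `-1` to the number of modes in `S` that precede `m`. -/
def jwSign {d M : ℕ} (m : Mode d M) (S : Finset (Mode d M)) : ℂ :=
  (-1) ^ (S.filter fun k => modeIndex k < modeIndex m).card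

/-- The annihilation operator of the mode `m`: it maps the basis state of `S` to
`jwSign m S` times the basis state of `S.erase m` when `m ∈ S`, and to `0` when `m ∉ S`. -/
def ann {d M : ℕ} (m : Mode d M) : Fock d M →ₗ[ℂ] Fock d M where
  toFun ψ := WithLp.toLp 2 fun S => if m ∈ S then 0 else jwSign m S * ψ (insert m S)
  map_add' ψ φ := by
    ext S
    by_cases h : m ∈ S <;> simp [h, mul_add]
  map_smul' a ψ := by
    ext S
    by_cases h : m ∈ S <;> simp [h, mul_left_comm]

/-- `f σ l` annihilates a fermion with internal state `σ` on the site `l`. -/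
def f {d M : ℕ} (σ : Spin) (l : Site d M) : Fock d M →ₗ[ℂ] Fock d M :=
  ann (l, σ)

/-- `fDag σ l` creates a fermion with internal state `σ` on the site `l`. -/
def fDag {d M : ℕ} (σ : Spin) (l : Site d M) : Fock d M →ₗ[ℂ] Fock d M :=
  LinearMap.adjoint (f σ l)

/-- The number operator of the mode `(l, σ)`. -/
def num {d M : ℕ} (σ : Spin) (l : Site d M) : Fock d M →ₗ[ℂ] Fock d M :=
  fDag σ l * f σ l

/-- The vacuum state. -/
def vacuum (d M : ℕ) : Fock d M := EuclideanSpace.single ∅ 1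

/-- The subspace of the states with `N` spin-up and `N` spin-down fermions. -/
def sector (d M N : ℕ) : Submodule ℂ (Fock d M) where
  carrier := {ψ | ∀ S : Finset (Mode d M),
    ¬((S.filter fun m => m.2 = up).card = N ∧ (S.filter fun m => m.2 = down).card = N) → ψ S = 0}
  zero_mem' := fun S _ => by simp
  add_mem' := fun hψ hφ S hS => by simp [hψ S hS, hφ S hS]
  smul_mem' := fun a ψ hψ S hS => by simp [hψ S hS]

/-- The neighbour of the site `l` in the positive direction `k`, with periodic boundary
conditions. -/
def next {d M : ℕ} [NeZero M] (l : Site d M) (k : Fin d) : Site d M :=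
  Function.update l k (l k + 1)

/-- The checkerboard sign of a site. -/
def checkerboard {d M : ℕ} (l : Site d M) : ℂ :=
  (-1) ^ (∑ k, (l k : ℕ))

/-- The operator creating a pair of fermions on the site `l`. -/
def pairDag {d M : ℕ} (l : Site d M) : Fock d M →ₗ[ℂ] Fock d M :=
  fDag up l * fDag down l

/-- The operator annihilating a pair of fermions on the site `l`, the adjoint of `pairDag l`. -/
def pair {d M : ℕ} (l : Site d M) : Fock d M →ₗ[ℂ] Fock d M :=
  LinearMap.adjoint (pairDag l)

/-- The `η`-creation operator. -/
def etaDag (d M : ℕ) : Fock d M →ₗ[ℂ] Fock d M :=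
  (1 / (Real.sqrt ((M : ℝ) ^ d) : ℂ)) • ∑ l : Site d M, checkerboard l • pairDag l

/-- The (unnormalized) `η`-condensate of `N` pairs. -/
def etaCondensate (d M N : ℕ) : Fock d M :=
  (etaDag d M ^ N) (vacuum d M)

/-- The Fermi–Hubbard Hamiltonian with tunneling rate `J` and on-site interaction `U`. -/
def hubbard (d M : ℕ) [NeZero M] (J U : ℝ) : Fock d M →ₗ[ℂ] Fock d M :=
  -(J : ℂ) • (∑ l : Site d M, ∑ k : Fin d, ∑ σ : Spin,
      (fDag σ l * f σ (next l k) + fDag σ (next l k) * f σ l))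
    + (U : ℂ) • ∑ l : Site d M, num up l * num down l

/-- The four jump operators on the pair of sites `l`, `l'`. -/
def bondJump {d M : ℕ} (l l' : Site d M) : Fin 4 → (Fock d M →ₗ[ℂ] Fock d M) :=
  ![(pairDag l - pairDag l') * (pair l + pair l'),
    num up l * fDag down l * f down l' + num up l' * fDag down l' * f down l,
    (fDag up l + fDag up l') * (f up l + f up l') * (1 - num down l) * (1 - num down l'),
    (fDag down l * f down l' + fDag down l' * f down l) * num up l * num up l']

/-- The labels of the jump operators: the number of the family, and a bond of the lattice, given
by a site and a direction. -/
abbrev JumpIndex (d M : ℕ) : Type := Fin 4 × Site d M × Fin d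

/-- The jump operators `c` of the driven process, four for each bond of the lattice. -/
def jump {d M : ℕ} [NeZero M] (j : JumpIndex d M) : Fock d M →ₗ[ℂ] Fock d M :=
  bondJump j.2.1 (next j.2.1 j.2.2) j.1

/-- The right-hand side of the master equation with Hamiltonian `H`, jump operators `c` and
dissipation rates `g`. -/
def liouvillian {d M : ℕ} {ι : Type*} [Fintype ι] (H : Fock d M →ₗ[ℂ] Fock d M)
    (c : ι → (Fock d M →ₗ[ℂ] Fock d M)) (g : ι → ℝ) (ρ : Fock d M →ₗ[ℂ] Fock d M) :
    Fock d M →ₗ[ℂ] Fock d M :=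
  -Complex.I • (H * ρ - ρ * H)
    + ∑ j, (g j : ℂ) • ((2 : ℂ) • (c j * ρ * LinearMap.adjoint (c j))
        - LinearMap.adjoint (c j) * c j * ρ - ρ * (LinearMap.adjoint (c j) * c j))

/-- Density operators on the space of states with `N` spin-up and `N` spin-down fermions, as
operators on the Fock space supported on this subspace (a positive operator with range in a
subspace vanishes on the orthogonal complement of the subspace). -/
structure IsDensityOperator {d M : ℕ} (N : ℕ) (ρ : Fock d M →ₗ[ℂ] Fock d M) : Prop where
  isPositive : ρ.IsPositive
  trace_eq_one : LinearMap.trace ℂ (Fock d M) ρ = 1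
  range_le : LinearMap.range ρ ≤ sector d M N

/-- The orthogonal projection onto the line spanned by `φ` (for `φ ≠ 0`). -/
def lineProjection {d M : ℕ} (φ : Fock d M) : Fock d M →ₗ[ℂ] Fock d M :=
  ((‖φ‖ : ℂ) ^ 2)⁻¹ • (InnerProductSpace.rankOne ℂ φ φ : Fock d M →L[ℂ] Fock d M).toLinearMap

end EtaCondensate

end

open EtaCondensate

open EtaCondensate

namespace EtaCondensate

variable {d M : ℕ}

/-! A local pair behaves as a hard-core boson, so `etaCondensate d M N` is a nonzero multiple of
`pairSum N ∅`, the sum over all `N`-element site sets `A` of the basis state with pairs on `A`,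
weighted by the product of its checkerboard signs. Adjacent sites have opposite signs because `M` is
even. Hence hopping cancels between the two positions of a pair on a bond, and so does the first
jump family; the other three families kill every state consisting only of pairs.

Uniqueness rests on one controllability statement, `AdjointInvariant.sector_le`: a subspace `W` that
contains the condensate and is stable under the adjoint jump operators contains the whole sector.
First, adjoints of the first family move a marked site along a bond, so connectedness and an
averaging argument put every `pairSum N B` into `W`; taking `B` with `N` elements isolates a single
configuration of pairs. Then the other three families reach configurations with broken pairs: a
singly occupied spin-up site is guided along a path towards a spin-down one, by induction on the
number of spin-up singles and on the path.

For dark states, let `χ` be the part of a dark vector orthogonal to the condensate. The orthogonal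
complement of `χ` satisfies the hypotheses of `sector_le`, so it contains `χ`, and `χ = 0`.

For a stationary `ρ`, taking the expectation of the master equation in a vector `v` that either lies
in the kernel of `ρ` or is the condensate leaves only the nonnegative terms `⟨c†v, ρ c†v⟩`. These
must all vanish, so every `c†` maps `ker ρ + span φ` into `ker ρ`, where `φ` is the condensate. By
`sector_le` this sum is the full space. Thus `ρ c† = 0`, hence `c ρ = 0`: the range of `ρ` is dark,
so it lies in the line of `φ`, and the trace fixes the remaining scalar. -/

/-! ### Occupation basis and anticommutation relations. -/

/-- The normalized position-basis state in which exactly the modes in `S` are occupied. -/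
noncomputable def ket (S : Finset (Mode d M)) : Fock d M := EuclideanSpace.single S 1

theorem ket_apply (S T : Finset (Mode d M)) : ket S T = if T = S then 1 else 0 := by
  simp [ket]

theorem eq_sum_ket (ψ : Fock d M) : ψ = ∑ S, ψ S • ket S := by
  ext T
  simp [ket_apply]

theorem linearMap_ext_ket {X Y : Fock d M →ₗ[ℂ] Fock d M} (h : ∀ S, X (ket S) = Y (ket S)) :
    X = Y := by
  ext1 ψ
  rw [eq_sum_ket ψ]
  simp only [map_sum, map_smul, h]

theorem modeIndex_injective : Function.Injective (modeIndex : Mode d M → ℕ) := by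
  rintro ⟨l, σ⟩ ⟨l', σ'⟩ h
  simp only [modeIndex] at h
  have hσ : (σ : ℕ) = σ' := by omega
  have hl : (finFunctionFinEquiv l : ℕ) = finFunctionFinEquiv l' := by omega
  rw [Prod.mk.injEq]
  exact ⟨finFunctionFinEquiv.injective (Fin.ext hl), Fin.ext hσ⟩

theorem jwSign_ne_zero (m : Mode d M) (S : Finset (Mode d M)) : jwSign m S ≠ 0 :=
  pow_ne_zero _ (by norm_num)

theorem jwSign_mul_self (m : Mode d M) (S : Finset (Mode d M)) :
    jwSign m S * jwSign m S = 1 := by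
  rw [jwSign, ← mul_pow]
  norm_num

theorem star_jwSign (m : Mode d M) (S : Finset (Mode d M)) :
    (starRingEnd ℂ) (jwSign m S) = jwSign m S := by
  simp [jwSign]

theorem jwSign_insert {m m' : Mode d M} {S : Finset (Mode d M)} (h : m' ∉ S) :
    jwSign m (insert m' S) = (if modeIndex m' < modeIndex m then -1 else 1) * jwSign m S := by
  unfold jwSign
  rw [Finset.filter_insert]
  split_ifs with hlt
  · rw [Finset.card_insert_of_notMem (by simp [h]), pow_succ]
    ring
  · simp

/-- Exactly one of two distinct modes precedes the other, so exactly one of the two signs is flipped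
by the insertion. This is the source of all anticommutation. -/
theorem jwSign_insert_swap {m m' : Mode d M} {S : Finset (Mode d M)} (hne : m ≠ m') (h : m ∉ S)
    (h' : m' ∉ S) :
    jwSign m (insert m' S) * jwSign m' S = -(jwSign m' (insert m S) * jwSign m S) := by
  rw [jwSign_insert h, jwSign_insert h']
  have := modeIndex_injective.ne hne
  rcases lt_or_gt_of_ne this with h1 | h1
  · rw [if_neg (by omega), if_pos h1]
    ring
  · rw [if_pos h1, if_neg (by omega)]
    ring

theorem ann_ket_of_notMem {m : Mode d M} {S : Finset (Mode d M)} (h : m ∉ S) :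
    ann m (ket S) = 0 := by
  ext T
  have : insert m T ≠ S := fun e => h (e ▸ Finset.mem_insert_self m T)
  simp [ann, ket_apply, this]

theorem ann_ket_insert {m : Mode d M} {S : Finset (Mode d M)} (h : m ∉ S) :
    ann m (ket (insert m S)) = jwSign m S • ket S := by
  ext T
  by_cases hT : m ∈ T
  · have : T ≠ S := fun e => h (e ▸ hT)
    simp [ann, ket_apply, hT, this]
  · have : insert m T = insert m S ↔ T = S := by
      constructor
      · intro e
        rw [← Finset.erase_insert hT, e, Finset.erase_insert h]
      · rintro rfl
        rfl
    simp only [ann, ket_apply, hT, this, LinearMap.coe_mk, AddHom.coe_mk, if_false,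
      PiLp.smul_apply, smul_eq_mul]
    split_ifs with e
    · rw [e]
    · simp

/-- The creation operator of the mode `m`. -/
noncomputable def create (m : Mode d M) : Fock d M →ₗ[ℂ] Fock d M := LinearMap.adjoint (ann m)

theorem inner_ket (S : Finset (Mode d M)) (ψ : Fock d M) : inner ℂ (ket S) ψ = ψ S := by
  simp [ket, EuclideanSpace.inner_single_left]

theorem create_apply (m : Mode d M) (ψ : Fock d M) (S : Finset (Mode d M)) :
    create m ψ S = inner ℂ (ann m (ket S)) ψ := by
  rw [← inner_ket, create, LinearMap.adjoint_inner_right]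

theorem create_ket_of_mem {m : Mode d M} {S : Finset (Mode d M)} (h : m ∈ S) :
    create m (ket S) = 0 := by
  ext T
  rw [create_apply]
  by_cases hT : m ∈ T
  · obtain ⟨T, hT', rfl⟩ : ∃ T', m ∉ T' ∧ insert m T' = T :=
      ⟨T.erase m, Finset.notMem_erase m T, Finset.insert_erase hT⟩
    rw [ann_ket_insert hT', inner_smul_left, inner_ket, ket_apply,
      if_neg (fun e : T = S => hT' (e ▸ h))]
    simp
  · simp [ann_ket_of_notMem hT]

theorem create_ket_of_notMem {m : Mode d M} {S : Finset (Mode d M)} (h : m ∉ S) :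
    create m (ket S) = jwSign m S • ket (insert m S) := by
  ext T
  rw [create_apply]
  by_cases hT : m ∈ T
  · obtain ⟨T, hT', rfl⟩ : ∃ T', m ∉ T' ∧ insert m T' = T :=
      ⟨T.erase m, Finset.notMem_erase m T, Finset.insert_erase hT⟩
    have : insert m T = insert m S ↔ T = S := by
      constructor
      · intro e
        rw [← Finset.erase_insert hT', e, Finset.erase_insert h]
      · rintro rfl
        rfl
    rw [ann_ket_insert hT', inner_smul_left, inner_ket, star_jwSign, PiLp.smul_apply, ket_apply,
      ket_apply, smul_eq_mul]
    simp only [this]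
    split_ifs with e
    · rw [e]
    · simp
  · rw [ann_ket_of_notMem hT, PiLp.smul_apply, ket_apply,
      if_neg (fun e : T = insert m S => hT (e ▸ Finset.mem_insert_self m S))]
    simp

theorem ann_ket_of_mem {m : Mode d M} {S : Finset (Mode d M)} (h : m ∈ S) :
    ann m (ket S) = jwSign m (S.erase m) • ket (S.erase m) := by
  conv_lhs => rw [← Finset.insert_erase h]
  exact ann_ket_insert (Finset.notMem_erase m S)

theorem create_mul_create {m m' : Mode d M} (h : m ≠ m') :
    create m * create m' = -(create m' * create m) := by
  apply linearMap_ext_ket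
  intro S
  simp only [Module.End.mul_apply, LinearMap.neg_apply]
  by_cases h1 : m ∈ S <;> by_cases h2 : m' ∈ S
  · simp [create_ket_of_mem h1, create_ket_of_mem h2]
  · have : m ∈ insert m' S := by simp [h1]
    simp [create_ket_of_mem h1, create_ket_of_notMem h2, create_ket_of_mem this]
  · have : m' ∈ insert m S := by simp [h2]
    simp [create_ket_of_mem h2, create_ket_of_notMem h1, create_ket_of_mem this]
  · have h3 : m ∉ insert m' S := by simp [h, h1]
    have h4 : m' ∉ insert m S := by simp [h.symm, h2]
    rw [create_ket_of_notMem h1, create_ket_of_notMem h2, map_smul, map_smul,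
      create_ket_of_notMem h3, create_ket_of_notMem h4, smul_smul, smul_smul,
      Finset.insert_comm m m' S, ← neg_smul]
    congr 1
    have := jwSign_insert_swap h h1 h2
    linear_combination this

theorem ann_mul_create {m m' : Mode d M} (h : m ≠ m') :
    ann m * create m' = -(create m' * ann m) := by
  apply linearMap_ext_ket
  intro S
  simp only [Module.End.mul_apply, LinearMap.neg_apply]
  by_cases h1 : m ∈ S <;> by_cases h2 : m' ∈ S
  · have : m' ∈ S.erase m := by simp [h.symm, h2]
    simp [create_ket_of_mem h2, ann_ket_of_mem h1, create_ket_of_mem this]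
  · obtain ⟨S, hS, rfl⟩ : ∃ T, m ∉ T ∧ insert m T = S :=
      ⟨S.erase m, Finset.notMem_erase m S, Finset.insert_erase h1⟩
    have h3 : m' ∉ S := fun e => h2 (Finset.mem_insert_of_mem e)
    have h4 : m ∉ insert m' S := by simp [h, hS]
    rw [create_ket_of_notMem h2, ann_ket_insert hS, map_smul, map_smul, Finset.insert_comm,
      ann_ket_insert h4, create_ket_of_notMem h3, smul_smul, smul_smul, ← neg_smul]
    congr 1
    have h5 := jwSign_insert_swap h hS h3
    have h6 := jwSign_mul_self m' S
    have h7 := jwSign_mul_self m' (insert m S)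
    -- Signs square to one, so multiplying the exchange relation by two of them moves these factors
    -- to the other side.
    linear_combination jwSign m' (insert m S) * jwSign m' S * h5
      - jwSign m' (insert m S) * jwSign m (insert m' S) * h6 - jwSign m S * jwSign m' S * h7
  · simp [create_ket_of_mem h2, ann_ket_of_notMem h1]
  · have : m ∉ insert m' S := by simp [h, h1]
    simp [create_ket_of_notMem h2, ann_ket_of_notMem h1, ann_ket_of_notMem this]

theorem ann_create_ket {m : Mode d M} {S : Finset (Mode d M)} (h : m ∉ S) :
    ann m (create m (ket S)) = ket S := by
  rw [create_ket_of_notMem h, map_smul, ann_ket_insert h, smul_smul, jwSign_mul_self, one_smul]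

theorem create_ann_ket (m : Mode d M) (S : Finset (Mode d M)) :
    create m (ann m (ket S)) = if m ∈ S then ket S else 0 := by
  split_ifs with h
  · rw [ann_ket_of_mem h, map_smul, create_ket_of_notMem (Finset.notMem_erase m S), smul_smul,
      jwSign_mul_self, one_smul, Finset.insert_erase h]
  · rw [ann_ket_of_notMem h, map_zero]

theorem exists_create_ann_ket {m m' : Mode d M} {S : Finset (Mode d M)} (h : m ∈ S)
    (h' : m' ∉ S) :
    ∃ ε : ℂ, ε ≠ 0 ∧ create m' (ann m (ket S)) = ε • ket (insert m' (S.erase m)) := by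
  have h'' : m' ∉ S.erase m := fun e => h' (Finset.mem_of_mem_erase e)
  refine ⟨jwSign m (S.erase m) * jwSign m' (S.erase m),
    mul_ne_zero (jwSign_ne_zero _ _) (jwSign_ne_zero _ _), ?_⟩
  rw [ann_ket_of_mem h, map_smul, create_ket_of_notMem h'', smul_smul]

theorem f_eq_ann (σ : Spin) (l : Site d M) : f σ l = ann (l, σ) := rfl

theorem fDag_eq_create (σ : Spin) (l : Site d M) : fDag σ l = create (l, σ) := rfl

theorem adjoint_f (σ : Spin) (l : Site d M) : LinearMap.adjoint (f σ l) = fDag σ l := rfl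

theorem adjoint_fDag (σ : Spin) (l : Site d M) : LinearMap.adjoint (fDag σ l) = f σ l :=
  LinearMap.adjoint_adjoint _

theorem adjoint_mul (X Y : Fock d M →ₗ[ℂ] Fock d M) :
    LinearMap.adjoint (X * Y) = LinearMap.adjoint Y * LinearMap.adjoint X :=
  LinearMap.adjoint_comp X Y

theorem adjoint_one : LinearMap.adjoint (1 : Fock d M →ₗ[ℂ] Fock d M) = 1 :=
  LinearMap.adjoint_id

theorem adjoint_num (σ : Spin) (l : Site d M) : LinearMap.adjoint (num σ l) = num σ l := by
  rw [num, adjoint_mul, adjoint_fDag, adjoint_f]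

theorem num_ket (σ : Spin) (l : Site d M) (S : Finset (Mode d M)) :
    num σ l (ket S) = if (l, σ) ∈ S then ket S else 0 :=
  create_ann_ket (l, σ) S

theorem num_commute (σ σ' : Spin) (l l' : Site d M) : Commute (num σ l) (num σ' l') := by
  apply linearMap_ext_ket
  intro S
  simp only [Module.End.mul_apply, num_ket]
  split_ifs <;> simp [num_ket, *]

/-! ### Local pairs as hard-core bosons. -/

/-- The modes of the sites in `A`. -/
def fullModes (A : Finset (Site d M)) : Finset (Mode d M) := A ×ˢ Finset.univ

@[simp] theorem mem_fullModes (A : Finset (Site d M)) (l : Site d M) (σ : Spin) :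
    (l, σ) ∈ fullModes A ↔ l ∈ A := by
  simp [fullModes]

theorem fullModes_injective : Function.Injective (fullModes : Finset (Site d M) → _) := by
  intro A B h
  ext l
  rw [← mem_fullModes A l up, h, mem_fullModes]

theorem fullModes_insert (l : Site d M) (A : Finset (Site d M)) :
    fullModes (insert l A) = insert (l, up) (insert (l, down) (fullModes A)) := by
  ext ⟨x, σ⟩
  fin_cases σ <;> simp

/-- The two modes of a site are consecutive in the ordering, so their Jordan–Wigner signs agree and
cancel: creating a pair costs no sign. -/
theorem pairDag_fullModes_of_notMem {l : Site d M} {A : Finset (Site d M)} (h : l ∉ A) :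
    pairDag l (ket (fullModes A)) = ket (fullModes (insert l A)) := by
  have h1 : (l, down) ∉ fullModes A := by simpa using h
  have h2 : (l, up) ∉ insert (l, down) (fullModes A) := by simp [h]
  rw [pairDag, Module.End.mul_apply, fDag_eq_create, fDag_eq_create, create_ket_of_notMem h1,
    map_smul, create_ket_of_notMem h2, smul_smul, fullModes_insert, jwSign_insert h1,
    if_neg (by simp [modeIndex])]
  have : jwSign (l, down) (fullModes A) = jwSign (l, up) (fullModes A) := by
    unfold jwSign
    congr 2
    apply Finset.filter_congr
    rintro ⟨x, σ⟩ hx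
    have hx' : x ≠ l := fun e => h (e ▸ (mem_fullModes A x σ).1 hx)
    have := (finFunctionFinEquiv.injective.ne hx')
    rw [Ne, Fin.ext_iff] at this
    have h0 : ((down : Spin) : ℕ) = 1 := rfl
    have h1 : ((up : Spin) : ℕ) = 0 := rfl
    have := σ.isLt
    simp only [modeIndex, h0, h1]
    omega
  rw [this, one_mul, jwSign_mul_self, one_smul]

theorem pairDag_fullModes_of_mem {l : Site d M} {A : Finset (Site d M)} (h : l ∈ A) :
    pairDag l (ket (fullModes A)) = 0 := by
  rw [pairDag, Module.End.mul_apply, fDag_eq_create down, create_ket_of_mem (by simpa using h),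
    map_zero]

theorem pair_eq (l : Site d M) : pair l = f down l * f up l := by
  rw [pair, pairDag, adjoint_mul, adjoint_fDag, adjoint_fDag]

theorem adjoint_pair (l : Site d M) : LinearMap.adjoint (pair l) = pairDag l :=
  LinearMap.adjoint_adjoint _

theorem pair_fullModes_of_notMem {l : Site d M} {A : Finset (Site d M)} (h : l ∉ A) :
    pair l (ket (fullModes A)) = 0 := by
  rw [pair_eq, Module.End.mul_apply, f_eq_ann up, ann_ket_of_notMem (by simpa using h), map_zero]

theorem pair_fullModes_insert {l : Site d M} {A : Finset (Site d M)} (h : l ∉ A) :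
    pair l (ket (fullModes (insert l A))) = ket (fullModes A) := by
  rw [← pairDag_fullModes_of_notMem h, pair_eq, pairDag, Module.End.mul_apply,
    Module.End.mul_apply, fDag_eq_create, fDag_eq_create, f_eq_ann, f_eq_ann]
  have h1 : (l, down) ∉ fullModes A := by simpa using h
  have h2 : (l, up) ∉ insert (l, down) (fullModes A) := by simp [h]
  conv_lhs => rw [create_ket_of_notMem h1]
  rw [map_smul, map_smul, ann_create_ket h2, map_smul, ann_ket_insert h1, smul_smul,
    jwSign_mul_self, one_smul]

/-! ### Bipartiteness and connectedness of the lattice. -/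

theorem next_ne [NeZero M] (hM : Even M) (l : Site d M) (k : Fin d) : l ≠ next l k := by
  intro h
  have h1 := congrFun h k
  have hM0 := NeZero.ne M
  obtain ⟨r, hr⟩ := hM
  simp [next] at h1
  omega

/-- Only the step from `M - 1` to `0` needs evenness: there the parity goes from odd to even because
`M` is even. -/
theorem neg_one_pow_val_add_one [NeZero M] (hM : Even M) (x : Fin M) :
    (-1 : ℂ) ^ ((x + 1 : Fin M) : ℕ) = -(-1) ^ (x : ℕ) := by
  have hM0 := NeZero.ne M
  have h2 : 1 < M := by
    obtain ⟨r, hr⟩ := hM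
    omega
  have hx := x.isLt
  rw [Fin.val_add, Fin.val_one', Nat.mod_eq_of_lt h2]
  rcases Nat.lt_or_ge ((x : ℕ) + 1) M with h | h
  · rw [Nat.mod_eq_of_lt h, pow_succ]
    ring
  · have : (x : ℕ) + 1 = M := by omega
    have h3 : (-1 : ℂ) ^ ((x : ℕ) + 1) = 1 := by rw [this, hM.neg_one_pow]
    rw [this, Nat.mod_self, pow_zero]
    rw [pow_succ] at h3
    linear_combination -h3

theorem checkerboard_next [NeZero M] (hM : Even M) (l : Site d M) (k : Fin d) :
    checkerboard (next l k) = -checkerboard l := by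
  unfold checkerboard next
  rw [← Finset.prod_pow_eq_pow_sum, ← Finset.prod_pow_eq_pow_sum,
    ← Finset.mul_prod_erase _ _ (Finset.mem_univ k),
    ← Finset.mul_prod_erase _ (fun i => (-1 : ℂ) ^ (l i : ℕ)) (Finset.mem_univ k),
    Function.update_self, neg_one_pow_val_add_one hM, neg_mul]
  congr 2
  apply Finset.prod_congr rfl
  intro i hi
  rw [Function.update_of_ne (Finset.ne_of_mem_erase hi)]

theorem checkerboard_ne_zero (l : Site d M) : checkerboard l ≠ 0 :=
  pow_ne_zero _ (by norm_num)

/-- Two sites joined by a bond, in either orientation. -/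
def Adj [NeZero M] (l l' : Site d M) : Prop :=
  (∃ k, l' = next l k) ∨ ∃ k, l = next l' k

theorem Adj.ne [NeZero M] (hM : Even M) {l l' : Site d M} (h : Adj l l') : l ≠ l' := by
  rcases h with ⟨k, rfl⟩ | ⟨k, rfl⟩
  · exact next_ne hM l k
  · exact (next_ne hM l' k).symm

/-- A coordinate is cyclic, so positive steps suffice: the value `v` is reached after `v - l k` of
them. -/
theorem reflTransGen_adj_update [NeZero M] (l : Site d M) (k : Fin d) (v : Fin M) :
    Relation.ReflTransGen Adj l (Function.update l k v) := by
  have key : ∀ n : ℕ, Relation.ReflTransGen Adj l (Function.update l k (l k + Fin.ofNat M n)) := by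
    intro n
    induction n with
    | zero =>
      have : l k + Fin.ofNat M 0 = l k := add_zero _
      rw [this, Function.update_eq_self]
    | succ n ih =>
      refine ih.tail (Or.inl ⟨k, ?_⟩)
      have : Fin.ofNat M (n + 1) = Fin.ofNat M n + 1 := by
        ext
        simp [Fin.val_add]
      rw [this, ← add_assoc]
      simp only [next, Function.update_self, Function.update_idem]
  have := key ((v - l k : Fin M) : ℕ)
  simpa using this

theorem reflTransGen_adj [NeZero M] (a b : Site d M) : Relation.ReflTransGen Adj a b := by
  have key : ∀ s : Finset (Fin d), Relation.ReflTransGen Adj a (s.piecewise b a) := by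
    intro s
    induction s using Finset.induction_on with
    | empty => simp [Relation.ReflTransGen.refl]
    | insert k s _ ih =>
      rw [Finset.piecewise_insert]
      exact ih.trans (reflTransGen_adj_update _ _ _)
  simpa using key Finset.univ

/-! ### The condensate as a signed sum over pair configurations. -/

/-- The state in which the sites in `A` are doubly occupied and the others are empty, with its
checkerboard sign. -/
noncomputable def pairKet (A : Finset (Site d M)) : Fock d M :=
  (∏ l ∈ A, checkerboard l) • ket (fullModes A)

theorem pairKet_insert {l : Site d M} {A : Finset (Site d M)} (h : l ∉ A) :
    pairKet (insert l A) =
      (checkerboard l * ∏ x ∈ A, checkerboard x) • ket (fullModes (insert l A)) := by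
  rw [pairKet, Finset.prod_insert h]

theorem checkerboard_smul_pairDag_pairKet (l : Site d M) (A : Finset (Site d M)) :
    checkerboard l • pairDag l (pairKet A) = if l ∈ A then 0 else pairKet (insert l A) := by
  split_ifs with h
  · simp [pairKet, pairDag_fullModes_of_mem h]
  · rw [pairKet_insert h, pairKet, map_smul, pairDag_fullModes_of_notMem h, smul_smul]

/-- The sum of the signed states of `N` pairs that occupy the sites in `B`. -/
noncomputable def pairSum (N : ℕ) (B : Finset (Site d M)) : Fock d M :=
  ∑ A with A.card = N ∧ B ⊆ A, pairKet A

/-- Double counting: each set of `k + 1` sites arises by adding any one of its elements to the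
others. -/
theorem sum_pairDag_pairSum (k : ℕ) :
    (∑ l : Site d M, checkerboard l • pairDag l) (pairSum k ∅) =
      ((k : ℂ) + 1) • pairSum (k + 1) (∅ : Finset (Site d M)) := by
  have h1 : (∑ l : Site d M, checkerboard l • pairDag l) (pairSum k ∅) =
      ∑ A with A.card = k, ∑ l with l ∉ A, pairKet (insert l A) := by
    simp only [pairSum, Finset.empty_subset, and_true, map_sum, LinearMap.sum_apply,
      LinearMap.smul_apply, checkerboard_smul_pairDag_pairKet]
    rw [Finset.sum_comm]
    rw [Finset.sum_comm]
    apply Finset.sum_congr rfl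
    intro A _
    rw [Finset.sum_filter]
    apply Finset.sum_congr rfl
    intro l _
    by_cases h : l ∈ A <;> simp [h]
  have h2 : ((k : ℂ) + 1) • pairSum (k + 1) (∅ : Finset (Site d M)) =
      ∑ A : Finset (Site d M) with A.card = k + 1, ∑ l ∈ A, pairKet A := by
    rw [pairSum, Finset.smul_sum]
    simp only [Finset.empty_subset, and_true]
    apply Finset.sum_congr rfl
    intro A hA
    rw [Finset.sum_const, (Finset.mem_filter.1 hA).2, ← Nat.cast_smul_eq_nsmul ℂ]
    simp
  rw [h1, h2, Finset.sum_sigma', Finset.sum_sigma']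
  refine Finset.sum_bij' (fun x _ => ⟨insert x.2 x.1, x.2⟩) (fun x _ => ⟨x.1.erase x.2, x.2⟩)
    ?_ ?_ ?_ ?_ ?_
  · rintro ⟨A, l⟩ h
    simp only [Finset.mem_sigma, Finset.mem_filter, Finset.mem_univ, true_and] at h ⊢
    exact ⟨by rw [Finset.card_insert_of_notMem h.2, h.1], Finset.mem_insert_self _ _⟩
  · rintro ⟨A, l⟩ h
    simp only [Finset.mem_sigma, Finset.mem_filter, Finset.mem_univ, true_and] at h ⊢
    exact ⟨by rw [Finset.card_erase_of_mem h.2, h.1, Nat.add_sub_cancel],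
      Finset.notMem_erase _ _⟩
  · rintro ⟨A, l⟩ h
    simp only [Finset.mem_sigma, Finset.mem_filter, Finset.mem_univ, true_and] at h
    simp [Finset.erase_insert h.2]
  · rintro ⟨A, l⟩ h
    simp only [Finset.mem_sigma, Finset.mem_filter, Finset.mem_univ, true_and] at h
    simp [Finset.insert_erase h.2]
  · intro x _
    rfl

/-- The factorial counts the orders in which the `N` pairs can be created. -/
theorem etaCondensate_eq (N : ℕ) :
    etaCondensate d M N =
      ((1 / (Real.sqrt ((M : ℝ) ^ d) : ℂ)) ^ N * (N.factorial : ℂ)) • pairSum N ∅ := by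
  induction N with
  | zero =>
    have : ∀ A : Finset (Site d M), (A.card = 0 ∧ ∅ ⊆ A) ↔ A = ∅ := by simp
    simp only [etaCondensate, pow_zero, Module.End.one_apply, pairSum, this]
    rw [Finset.sum_filter, Finset.sum_ite_eq' Finset.univ (∅ : Finset (Site d M))]
    simp [pairKet, vacuum, ket, fullModes]
  | succ N ih =>
    rw [etaCondensate, pow_succ', Module.End.mul_apply, ← etaCondensate, ih, map_smul, etaDag,
      LinearMap.smul_apply, sum_pairDag_pairSum, smul_smul, smul_smul, Nat.factorial_succ]
    congr 1
    push_cast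
    ring

theorem pairKet_fullModes (A B : Finset (Site d M)) :
    pairKet A (fullModes B) = if A = B then ∏ l ∈ A, checkerboard l else 0 := by
  simp only [pairKet, PiLp.smul_apply, ket_apply, fullModes_injective.eq_iff, eq_comm (a := B)]
  simp

theorem pairSum_empty_fullModes {N : ℕ} {B : Finset (Site d M)} (hB : B.card = N) :
    pairSum N ∅ (fullModes B) = ∏ l ∈ B, checkerboard l := by
  rw [pairSum, WithLp.ofLp_sum, Finset.sum_apply]
  simp [pairKet_fullModes, hB]

theorem etaCondensate_coeff_ne_zero [NeZero M] (N : ℕ) :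
    (1 / (Real.sqrt ((M : ℝ) ^ d) : ℂ)) ^ N * (N.factorial : ℂ) ≠ 0 := by
  have hM : (0 : ℝ) < M := by exact_mod_cast Nat.pos_of_ne_zero (NeZero.ne M)
  have : Real.sqrt ((M : ℝ) ^ d) ≠ 0 := (Real.sqrt_pos.2 (by positivity)).ne'
  refine mul_ne_zero (pow_ne_zero _ (one_div_ne_zero (by exact_mod_cast this))) ?_
  exact_mod_cast N.factorial_ne_zero

theorem etaCondensate_ne_zero [NeZero M] {N : ℕ} (hN : N ≤ M ^ d) : etaCondensate d M N ≠ 0 := by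
  have : N ≤ (Finset.univ : Finset (Site d M)).card := by simpa using hN
  obtain ⟨B, -, hB⟩ := Finset.exists_subset_card_eq this
  rw [etaCondensate_eq]
  refine smul_ne_zero (etaCondensate_coeff_ne_zero N) fun h => ?_
  have h1 := pairSum_empty_fullModes hB
  rw [h] at h1
  exact Finset.prod_ne_zero_iff.2 (fun l _ => checkerboard_ne_zero l) h1.symm

/-- The position-basis states with `N` spin-up and `N` spin-down fermions. -/
def IsBalanced (N : ℕ) (S : Finset (Mode d M)) : Prop :=
  (S.filter fun m => m.2 = up).card = N ∧ (S.filter fun m => m.2 = down).card = N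

theorem ket_mem_sector {N : ℕ} {S : Finset (Mode d M)} (h : IsBalanced N S) :
    ket S ∈ sector d M N := by
  intro T hT
  rw [ket_apply, if_neg]
  rintro rfl
  exact hT h

theorem card_fullModes_filter (A : Finset (Site d M)) (σ : Spin) :
    ((fullModes A).filter fun m => m.2 = σ).card = A.card := by
  have : ((fullModes A).filter fun m => m.2 = σ) = A ×ˢ {σ} := by
    ext ⟨l, τ⟩
    simp [eq_comm]
  rw [this, Finset.card_product, Finset.card_singleton, mul_one]

theorem isBalanced_fullModes {N : ℕ} {A : Finset (Site d M)} (h : A.card = N) :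
    IsBalanced N (fullModes A) :=
  ⟨by rw [card_fullModes_filter, h], by rw [card_fullModes_filter, h]⟩

theorem etaCondensate_mem_sector (N : ℕ) : etaCondensate d M N ∈ sector d M N := by
  rw [etaCondensate_eq]
  refine Submodule.smul_mem _ _ (Submodule.sum_mem _ fun A hA => Submodule.smul_mem _ _ ?_)
  exact ket_mem_sector (isBalanced_fullModes (Finset.mem_filter.1 hA).2.1)

/-! ### Exchange symmetry on a bond and the Hamiltonian. -/

/-- The exchange of the sites `l` and `l'`, acting on sets of sites. -/
def siteSwap (l l' : Site d M) : Finset (Site d M) ≃ Finset (Site d M) :=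
  (Equiv.swap l l').finsetCongr

theorem siteSwap_comm (l l' : Site d M) : siteSwap l l' = siteSwap l' l := by
  rw [siteSwap, Equiv.swap_comm, siteSwap]

theorem mem_siteSwap (l l' x : Site d M) (A : Finset (Site d M)) :
    x ∈ siteSwap l l' A ↔ Equiv.swap l l' x ∈ A := by
  simp only [siteSwap, Equiv.finsetCongr_apply, Finset.mem_map_equiv, Equiv.symm_swap]

theorem siteSwap_siteSwap (l l' : Site d M) (A : Finset (Site d M)) :
    siteSwap l l' (siteSwap l l' A) = A := by
  ext x
  simp [mem_siteSwap]

theorem card_siteSwap (l l' : Site d M) (A : Finset (Site d M)) :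
    (siteSwap l l' A).card = A.card := by
  simp [siteSwap]

theorem siteSwap_insert {l l' : Site d M} {B : Finset (Site d M)} (h : l ∉ B)
    (h' : l' ∉ B) : siteSwap l l' (insert l B) = insert l' B := by
  ext x
  rw [mem_siteSwap, Equiv.swap_apply_def, Finset.mem_insert, Finset.mem_insert]
  by_cases h1 : x = l
  · subst h1
    by_cases h2 : l' = x
    · simp [h2]
    · simp [h2, h, h', Ne.symm h2]
  · by_cases h2 : x = l'
    · simp [h2]
    · simp [h1, h2]

theorem siteSwap_insert' {l l' : Site d M} {B : Finset (Site d M)} (h : l ∉ B)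
    (h' : l' ∉ B) : siteSwap l l' (insert l' B) = insert l B := by
  rw [siteSwap_comm, siteSwap_insert h' h]

/-- The difference of the occupations of the sites `l` and `l'`. -/
def occDiff (l l' : Site d M) (A : Finset (Site d M)) : ℂ :=
  (if l ∈ A then 1 else 0) - (if l' ∈ A then 1 else 0)

theorem occDiff_siteSwap (l l' : Site d M) (A : Finset (Site d M)) :
    occDiff l l' (siteSwap l l' A) = -occDiff l l' A := by
  simp [occDiff, mem_siteSwap]

/-- A set of sites either has equal occupations of `l` and `l'`, or contains exactly one of
them. -/
theorem bond_cases {l l' : Site d M} (P : Finset (Site d M) → Prop)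
    (h0 : ∀ A, (l ∈ A ↔ l' ∈ A) → P A)
    (h1 : ∀ B, l ∉ B → l' ∉ B → P (insert l B))
    (h2 : ∀ B, l ∉ B → l' ∉ B → P (insert l' B)) (A : Finset (Site d M)) : P A := by
  by_cases h : l ∈ A
  · by_cases h' : l' ∈ A
    · exact h0 A (by simp [h, h'])
    · rw [← Finset.insert_erase h]
      exact h1 _ (Finset.notMem_erase _ _) fun e => h' (Finset.mem_of_mem_erase e)
  · by_cases h' : l' ∈ A
    · rw [← Finset.insert_erase h']
      exact h2 _ (fun e => h (Finset.mem_of_mem_erase e)) (Finset.notMem_erase _ _)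
    · exact h0 A (by simp [h, h'])

/-- With equal occupations either nothing can be annihilated or the two contributions cancel. With
one pair on the bond, the pair is put back or transferred, and the opposite checkerboard signs turn
the relative plus into a minus. -/
theorem pairDag_add_apply_pair_sub {l l' : Site d M} (hne : l ≠ l')
    (hs : checkerboard l' = -checkerboard l) (A : Finset (Site d M)) :
    ((pairDag l + pairDag l') * (pair l - pair l')) (pairKet A) =
      occDiff l l' A • (pairKet A - pairKet (siteSwap l l' A)) := by
  induction A using bond_cases (l := l) (l' := l') with
  | h0 A h =>
    have hz : occDiff l l' A = 0 := by simp [occDiff, h]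
    rw [hz, zero_smul]
    by_cases h1 : l ∈ A
    · obtain ⟨B, hB, hB', rfl⟩ : ∃ B, l ∉ B ∧ l' ∉ B ∧ insert l (insert l' B) = A := by
        refine ⟨(A.erase l).erase l', by simp, by simp, ?_⟩
        rw [Finset.insert_erase (by simp [hne.symm, h.1 h1]), Finset.insert_erase h1]
      have h3 : l ∉ insert l' B := by simp [hne, hB]
      have h4 : l' ∉ insert l B := by simp [hne.symm, hB']
      simp only [pairKet, Module.End.mul_apply, map_smul, LinearMap.sub_apply,
        LinearMap.add_apply]
      rw [pair_fullModes_insert h3, Finset.insert_comm, pair_fullModes_insert h4, map_sub, map_sub,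
        pairDag_fullModes_of_notMem h3, pairDag_fullModes_of_notMem h4,
        pairDag_fullModes_of_mem (by simp : l ∈ insert l B),
        pairDag_fullModes_of_mem (by simp : l' ∈ insert l' B), Finset.insert_comm]
      simp
    · have h2 : l' ∉ A := fun e => h1 (h.2 e)
      simp [pairKet, pair_fullModes_of_notMem h1, pair_fullModes_of_notMem h2]
  | h1 B h h' =>
    have hz : occDiff l l' (insert l B) = 1 := by simp [occDiff, h', hne.symm]
    have h4 : l' ∉ insert l B := by simp [hne.symm, h']
    rw [hz, one_smul, siteSwap_insert h h', pairKet_insert h, pairKet_insert h', map_smul,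
      Module.End.mul_apply, LinearMap.sub_apply, pair_fullModes_insert h,
      pair_fullModes_of_notMem h4, sub_zero, LinearMap.add_apply, pairDag_fullModes_of_notMem h,
      pairDag_fullModes_of_notMem h', hs]
    module
  | h2 B h h' =>
    have hz : occDiff l l' (insert l' B) = -1 := by simp [occDiff, h, hne]
    have h4 : l ∉ insert l' B := by simp [hne, h]
    rw [hz, siteSwap_insert' h h', pairKet_insert h, pairKet_insert h', map_smul,
      Module.End.mul_apply, LinearMap.sub_apply, pair_fullModes_insert h',
      pair_fullModes_of_notMem h4, zero_sub, LinearMap.add_apply, map_neg, map_neg,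
      pairDag_fullModes_of_notMem h, pairDag_fullModes_of_notMem h', hs]
    module

theorem pairDag_sub_apply_pair_add {l l' : Site d M} (hne : l ≠ l')
    (hs : checkerboard l' = -checkerboard l) (A : Finset (Site d M)) :
    ((pairDag l - pairDag l') * (pair l + pair l')) (pairKet A) =
      occDiff l l' A • (pairKet A + pairKet (siteSwap l l' A)) := by
  induction A using bond_cases (l := l) (l' := l') with
  | h0 A h =>
    have hz : occDiff l l' A = 0 := by simp [occDiff, h]
    rw [hz, zero_smul]
    by_cases h1 : l ∈ A
    · obtain ⟨B, hB, hB', rfl⟩ : ∃ B, l ∉ B ∧ l' ∉ B ∧ insert l (insert l' B) = A := by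
        refine ⟨(A.erase l).erase l', by simp, by simp, ?_⟩
        rw [Finset.insert_erase (by simp [hne.symm, h.1 h1]), Finset.insert_erase h1]
      have h3 : l ∉ insert l' B := by simp [hne, hB]
      have h4 : l' ∉ insert l B := by simp [hne.symm, hB']
      simp only [pairKet, Module.End.mul_apply, map_smul, LinearMap.sub_apply,
        LinearMap.add_apply]
      rw [pair_fullModes_insert h3, Finset.insert_comm, pair_fullModes_insert h4, map_add, map_add,
        pairDag_fullModes_of_notMem h3, pairDag_fullModes_of_notMem h4,
        pairDag_fullModes_of_mem (by simp : l ∈ insert l B),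
        pairDag_fullModes_of_mem (by simp : l' ∈ insert l' B), Finset.insert_comm]
      simp
    · have h2 : l' ∉ A := fun e => h1 (h.2 e)
      simp [pairKet, pair_fullModes_of_notMem h1, pair_fullModes_of_notMem h2]
  | h1 B h h' =>
    have hz : occDiff l l' (insert l B) = 1 := by simp [occDiff, h', hne.symm]
    have h4 : l' ∉ insert l B := by simp [hne.symm, h']
    rw [hz, one_smul, siteSwap_insert h h', pairKet_insert h, pairKet_insert h', map_smul,
      Module.End.mul_apply, LinearMap.add_apply, pair_fullModes_insert h,
      pair_fullModes_of_notMem h4, add_zero, LinearMap.sub_apply, pairDag_fullModes_of_notMem h,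
      pairDag_fullModes_of_notMem h', hs]
    module
  | h2 B h h' =>
    have hz : occDiff l l' (insert l' B) = -1 := by simp [occDiff, h, hne]
    have h4 : l ∉ insert l' B := by simp [hne, h]
    rw [hz, siteSwap_insert' h h', pairKet_insert h, pairKet_insert h', map_smul,
      Module.End.mul_apply, LinearMap.add_apply, pair_fullModes_insert h',
      pair_fullModes_of_notMem h4, zero_add, LinearMap.sub_apply,
      pairDag_fullModes_of_notMem h, pairDag_fullModes_of_notMem h', hs]
    module

theorem sum_card_siteSwap (l l' : Site d M) (N : ℕ) (F : Finset (Site d M) → Fock d M) :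
    ∑ A with A.card = N, F (siteSwap l l' A) = ∑ A with A.card = N, F A := by
  rw [Finset.sum_filter, Finset.sum_filter,
    ← Equiv.sum_comp (siteSwap l l') fun A => if A.card = N then F A else 0]
  simp only [card_siteSwap]

/-- An operator that is odd under the exchange of `l` and `l'` on signed pair states annihilates
the condensate. -/
theorem apply_pairSum_eq_zero {X : Fock d M →ₗ[ℂ] Fock d M} {l l' : Site d M}
    (h : ∀ A, X (pairKet (siteSwap l l' A)) = -X (pairKet A)) (N : ℕ) :
    X (pairSum N ∅) = 0 := by
  -- The exchange permutes the `N`-element sets, so the sum equals its own negative.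
  have h1 := sum_card_siteSwap l l' N (fun A => X (pairKet A))
  simp only [h, Finset.sum_neg_distrib] at h1
  simp only [pairSum, Finset.empty_subset, and_true, map_sum]
  generalize ∑ A with A.card = N, X (pairKet A) = ψ at h1 ⊢
  have h2 : (2 : ℂ) • ψ = 0 := by
    rw [two_smul]
    nth_rewrite 1 [← h1]
    exact neg_add_cancel ψ
  exact (smul_eq_zero.1 h2).resolve_left two_ne_zero

/-- The hopping of both spin components between the sites `l` and `l'`. -/
noncomputable def hop (l l' : Site d M) : Fock d M →ₗ[ℂ] Fock d M :=
  ∑ σ : Spin, (fDag σ l * f σ l' + fDag σ l' * f σ l)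

theorem hop_comm (l l' : Site d M) : hop l l' = hop l' l :=
  Finset.sum_congr rfl fun _ _ => add_comm _ _

theorem ann_create_apply {m m' : Mode d M} (h : m ≠ m') (ψ : Fock d M) :
    ann m (create m' ψ) = -create m' (ann m ψ) :=
  LinearMap.congr_fun (ann_mul_create h) ψ

theorem create_create_apply {m m' : Mode d M} (h : m ≠ m') (ψ : Fock d M) :
    create m (create m' ψ) = -create m' (create m ψ) :=
  LinearMap.congr_fun (create_mul_create h) ψ

theorem ann_create_self_apply (m : Mode d M) (ψ : Fock d M) :
    ann m (create m ψ) = ψ - create m (ann m ψ) := by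
  have : ann m * create m = 1 - create m * ann m := by
    apply linearMap_ext_ket
    intro S
    simp only [Module.End.mul_apply, LinearMap.sub_apply, Module.End.one_apply, create_ann_ket]
    by_cases h : m ∈ S
    · simp [create_ket_of_mem h, h]
    · simp [ann_create_ket h, h]
  exact LinearMap.congr_fun this ψ

/-- The right-hand side is a spin singlet on the bond, symmetric in `l` and `l'`. A pair on either
site therefore breaks into the same state, and the staggered signs make the two contributions
cancel. -/
theorem hop_fullModes_insert {l l' : Site d M} (hne : l ≠ l') {B : Finset (Site d M)}
    (h : l ∉ B) (h' : l' ∉ B) :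
    hop l l' (ket (fullModes (insert l B))) =
      create (l', up) (create (l, down) (ket (fullModes B))) +
        create (l, up) (create (l', down) (ket (fullModes B))) := by
  have e : ∀ σ τ : Spin, (l', σ) ≠ (l, τ) := fun σ τ e => hne (congrArg Prod.fst e).symm
  have e1 : ((l, up) : Mode d M) ≠ (l, down) := by simp
  have e2 : ((l, down) : Mode d M) ≠ (l, up) := by simp
  have a1 : ∀ σ, ann (l, σ) (ket (fullModes B)) = 0 := fun σ =>
    ann_ket_of_notMem (by simpa using h)
  have a2 : ∀ σ, ann (l', σ) (ket (fullModes B)) = 0 := fun σ =>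
    ann_ket_of_notMem (by simpa using h')
  rw [← pairDag_fullModes_of_notMem h, hop, Fin.sum_univ_two]
  simp only [pairDag, LinearMap.add_apply, Module.End.mul_apply, fDag_eq_create, f_eq_ann,
    ann_create_apply (e _ _), ann_create_apply e1, ann_create_apply e2, ann_create_self_apply, a1,
    a2, map_zero, neg_zero, sub_zero, zero_add, map_neg]
  rw [create_create_apply (e down up), neg_neg]

theorem hop_pairKet_siteSwap {l l' : Site d M} (hne : l ≠ l')
    (hs : checkerboard l' = -checkerboard l) (A : Finset (Site d M)) :
    hop l l' (pairKet (siteSwap l l' A)) = -hop l l' (pairKet A) := by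
  have key : ∀ B : Finset (Site d M), l ∉ B → l' ∉ B →
      hop l l' (pairKet (insert l' B)) = -hop l l' (pairKet (insert l B)) := by
    intro B h h'
    rw [pairKet_insert h, pairKet_insert h', map_smul, map_smul, hop_fullModes_insert hne h h',
      hop_comm, hop_fullModes_insert hne.symm h' h, hs]
    module
  induction A using bond_cases (l := l) (l' := l') with
  | h0 A h =>
    -- With both sites empty there is nothing to move; with both full, Pauli exclusion blocks the
    -- hop.
    have key2 : ∀ A : Finset (Site d M), (l ∈ A ↔ l' ∈ A) → hop l l' (pairKet A) = 0 := by
      intro A h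
      rw [pairKet, map_smul, hop, LinearMap.sum_apply]
      convert smul_zero _
      apply Finset.sum_eq_zero
      intro σ _
      simp only [LinearMap.add_apply, Module.End.mul_apply, f_eq_ann, fDag_eq_create]
      by_cases h1 : l ∈ A
      · have h2 := h.1 h1
        have h3 : (l, σ) ∈ (fullModes A).erase (l', σ) := by simp [hne, h1]
        have h4 : (l', σ) ∈ (fullModes A).erase (l, σ) := by simp [hne.symm, h2]
        rw [ann_ket_of_mem (by simpa using h2), ann_ket_of_mem (by simpa using h1), map_smul,
          map_smul, create_ket_of_mem h3, create_ket_of_mem h4]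
        simp
      · have h2 : l' ∉ A := fun e => h1 (h.2 e)
        rw [ann_ket_of_notMem (by simpa using h2), ann_ket_of_notMem (by simpa using h1)]
        simp
    rw [key2 A h, key2, neg_zero]
    simp [mem_siteSwap, h]
  | h1 B h h' => rw [siteSwap_insert h h', key B h h']
  | h2 B h h' => rw [siteSwap_insert' h h', key B h h', neg_neg]

theorem sum_num_mul_num_pairKet (A : Finset (Site d M)) :
    (∑ l : Site d M, num up l * num down l) (pairKet A) = (A.card : ℂ) • pairKet A := by
  have : ∀ l : Site d M, (num up l * num down l) (pairKet A) = if l ∈ A then pairKet A else 0 := by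
    intro l
    rw [pairKet, map_smul, Module.End.mul_apply, num_ket]
    by_cases h : l ∈ A <;> simp [num_ket, h]
  simp only [LinearMap.sum_apply, this]
  rw [Finset.sum_ite_mem, Finset.univ_inter, Finset.sum_const, Nat.cast_smul_eq_nsmul]

theorem hubbard_eq [NeZero M] (J U : ℝ) :
    hubbard d M J U = -(J : ℂ) • (∑ l : Site d M, ∑ k : Fin d, hop l (next l k))
      + (U : ℂ) • ∑ l : Site d M, num up l * num down l := rfl

theorem hubbard_etaCondensate [NeZero M] (hM : Even M) (J U : ℝ) (N : ℕ) :
    hubbard d M J U (etaCondensate d M N) = ((N : ℂ) * (U : ℂ)) • etaCondensate d M N := by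
  have h1 : ∀ (l : Site d M) (k : Fin d), hop l (next l k) (pairSum N ∅) = 0 := fun l k =>
    apply_pairSum_eq_zero (hop_pairKet_siteSwap (next_ne hM l k) (checkerboard_next hM l k)) N
  have h2 : (∑ l : Site d M, num up l * num down l) (pairSum N ∅) = (N : ℂ) • pairSum N ∅ := by
    rw [pairSum, map_sum, Finset.smul_sum]
    refine Finset.sum_congr rfl fun A hA => ?_
    rw [sum_num_mul_num_pairKet, (Finset.mem_filter.1 hA).2.1]
  have h4 : (∑ l : Site d M, ∑ k : Fin d, hop l (next l k)) (pairSum N ∅) = 0 := by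
    simp only [LinearMap.sum_apply, h1, Finset.sum_const_zero]
  rw [etaCondensate_eq, map_smul, hubbard_eq, LinearMap.add_apply, LinearMap.smul_apply,
    LinearMap.smul_apply, h4, h2]
  module

/-! ### The condensate is dark. -/

theorem bondJump_zero (l l' : Site d M) :
    bondJump l l' 0 = (pairDag l - pairDag l') * (pair l + pair l') := rfl

theorem bondJump_one (l l' : Site d M) :
    bondJump l l' 1 =
      num up l * fDag down l * f down l' + num up l' * fDag down l' * f down l := rfl

theorem bondJump_two (l l' : Site d M) :
    bondJump l l' 2 =
      (fDag up l + fDag up l') * (f up l + f up l') * (1 - num down l) * (1 - num down l') := rfl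

theorem bondJump_three (l l' : Site d M) :
    bondJump l l' 3 =
      (fDag down l * f down l' + fDag down l' * f down l) * num up l * num up l' := rfl

/-- Jumps are indexed by positively oriented bonds; since reversal costs at most a sign, an
invariant subspace may be explored along bonds in either direction. -/
theorem bondJump_swap (l l' : Site d M) (i : Fin 4) :
    bondJump l' l i = bondJump l l' i ∨ bondJump l' l i = -bondJump l l' i := by
  fin_cases i
  · right
    change bondJump l' l 0 = -bondJump l l' 0
    rw [bondJump_zero, bondJump_zero, add_comm, ← neg_mul, neg_sub]
  · left
    exact add_comm _ _
  · left
    change bondJump l' l 2 = bondJump l l' 2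
    have h : Commute (1 - num down l) (1 - num down l') :=
      ((Commute.one_left _).sub_left ((Commute.one_right _).sub_right (num_commute _ _ _ _)))
    rw [bondJump_two, bondJump_two, mul_assoc _ (1 - num down l'), ← h.eq, ← mul_assoc,
      add_comm (fDag up l'), add_comm (f up l')]
  · left
    change bondJump l' l 3 = bondJump l l' 3
    rw [bondJump_three, bondJump_three, mul_assoc _ (num up l'), (num_commute up up l' l).eq,
      ← mul_assoc, add_comm (fDag down l' * f down l)]

theorem num_pairKet (σ : Spin) (l : Site d M) (A : Finset (Site d M)) :
    num σ l (pairKet A) = if l ∈ A then pairKet A else 0 := by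
  rw [pairKet, map_smul, num_ket]
  by_cases h : l ∈ A <;> simp [h]

theorem num_create_ann_fullModes {l l' : Site d M} (hne : l ≠ l') (A : Finset (Site d M)) :
    num up l (create (l, down) (ann (l', down) (ket (fullModes A)))) = 0 := by
  by_cases h' : l' ∈ A
  · by_cases h : l ∈ A
    · have : (l, down) ∈ (fullModes A).erase (l', down) := by simp [hne, h]
      rw [ann_ket_of_mem (by simpa using h'), map_smul, create_ket_of_mem this]
      simp
    · have h1 : (l, down) ∉ fullModes A := by simpa using h
      obtain ⟨ε, -, hε⟩ := exists_create_ann_ket (m := (l', down)) (m' := (l, down))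
        (S := fullModes A) (by simpa using h') h1
      rw [hε, map_smul, num_ket, if_neg, smul_zero]
      simp [h]
  · rw [ann_ket_of_notMem (by simpa using h'), map_zero, map_zero]

/-- Only family `0` needs cancellation between configurations. Family `1` would need a spin-up
fermion on the site that receives the spin-down one, family `2` a spin-up fermion without its
partner, and family `3` a free spin-down mode where both sites carry pairs. -/
theorem bondJump_pairSum {l l' : Site d M} (hne : l ≠ l')
    (hs : checkerboard l' = -checkerboard l) (i : Fin 4) (N : ℕ) :
    bondJump l l' i (pairSum N ∅) = 0 := by
  have kill : ∀ X : Fock d M →ₗ[ℂ] Fock d M, (∀ A, X (pairKet A) = 0) → X (pairSum N ∅) = 0 := by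
    intro X h
    simp [pairSum, h]
  fin_cases i
  · refine apply_pairSum_eq_zero (l := l) (l' := l') (fun A => ?_) N
    change bondJump l l' 0 _ = -bondJump l l' 0 _
    rw [bondJump_zero, pairDag_sub_apply_pair_add hne hs, pairDag_sub_apply_pair_add hne hs,
      siteSwap_siteSwap, occDiff_siteSwap]
    module
  · refine kill _ fun A => ?_
    change bondJump l l' 1 _ = 0
    simp only [bondJump_one, LinearMap.add_apply, Module.End.mul_apply, pairKet, map_smul,
      fDag_eq_create, f_eq_ann, num_create_ann_fullModes hne, num_create_ann_fullModes hne.symm,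
      smul_zero, add_zero]
  · refine kill _ fun A => ?_
    change bondJump l l' 2 _ = 0
    simp only [bondJump_two, Module.End.mul_apply]
    have hnum : ∀ x : Site d M,
        (1 - num down x) (pairKet A) = if x ∈ A then 0 else pairKet A := by
      intro x
      rw [LinearMap.sub_apply, num_pairKet]
      split_ifs <;> simp
    rw [hnum]
    by_cases h' : l' ∈ A
    · simp [h']
    · rw [if_neg h', hnum]
      by_cases h : l ∈ A
      · simp [h]
      · rw [if_neg h, pairKet, map_smul, LinearMap.add_apply (f up l),
          f_eq_ann, f_eq_ann, ann_ket_of_notMem (by simpa using h),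
          ann_ket_of_notMem (by simpa using h')]
        simp
  · refine kill _ fun A => ?_
    change bondJump l l' 3 _ = 0
    simp only [bondJump_three, Module.End.mul_apply]
    rw [num_pairKet]
    by_cases h' : l' ∈ A
    · rw [if_pos h', num_pairKet]
      by_cases h : l ∈ A
      · have h3 : (l, down) ∈ (fullModes A).erase (l', down) := by simp [hne, h]
        have h4 : (l', down) ∈ (fullModes A).erase (l, down) := by simp [hne.symm, h']
        rw [if_pos h, pairKet, map_smul]
        simp only [LinearMap.add_apply, Module.End.mul_apply, f_eq_ann, fDag_eq_create]
        rw [ann_ket_of_mem (by simpa using h'), ann_ket_of_mem (by simpa using h), map_smul,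
          map_smul, create_ket_of_mem h3, create_ket_of_mem h4]
        simp
      · simp [h]
    · simp [h']

theorem jump_etaCondensate [NeZero M] (hM : Even M) (j : JumpIndex d M) (N : ℕ) :
    jump j (etaCondensate d M N) = 0 := by
  rw [etaCondensate_eq, map_smul, jump,
    bondJump_pairSum (next_ne hM _ _) (checkerboard_next hM _ _), smul_zero]

/-! ### Adjoint jumps generate all configurations of pairs. -/

/-- The subspace `W` is invariant under the adjoints of all jump operators. -/
def AdjointInvariant [NeZero M] (W : Submodule ℂ (Fock d M)) : Prop :=
  ∀ j : JumpIndex d M, ∀ w ∈ W, LinearMap.adjoint (jump j) w ∈ W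

theorem AdjointInvariant.bondJump_mem [NeZero M] {W : Submodule ℂ (Fock d M)}
    (hW : AdjointInvariant W) {l l' : Site d M} (h : Adj l l') (i : Fin 4) {w : Fock d M}
    (hw : w ∈ W) : LinearMap.adjoint (bondJump l l' i) w ∈ W := by
  rcases h with ⟨k, rfl⟩ | ⟨k, rfl⟩
  · exact hW (i, l, k) w hw
  · have := hW (i, l', k) w hw
    rcases bondJump_swap l' (next l' k) i with h | h
    · rw [h]
      exact this
    · rw [h, map_neg]
      exact W.neg_mem this

theorem adjoint_bondJump_zero (l l' : Site d M) :
    LinearMap.adjoint (bondJump l l' 0) = (pairDag l + pairDag l') * (pair l - pair l') := by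
  rw [bondJump_zero, adjoint_mul, map_add, map_sub, adjoint_pair, adjoint_pair]
  rfl

theorem adjoint_bondJump_one (l l' : Site d M) :
    LinearMap.adjoint (bondJump l l' 1) =
      fDag down l' * (f down l * num up l) + fDag down l * (f down l' * num up l') := by
  simp only [bondJump_one, adjoint_mul, map_add, adjoint_fDag, adjoint_f, adjoint_num]

theorem adjoint_bondJump_two (l l' : Site d M) :
    LinearMap.adjoint (bondJump l l' 2) =
      (1 - num down l') * ((1 - num down l) * ((fDag up l + fDag up l') * (f up l + f up l'))) := by
  simp only [bondJump_two, adjoint_mul, map_add, map_sub, adjoint_fDag, adjoint_f, adjoint_num,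
    adjoint_one]

theorem adjoint_bondJump_three (l l' : Site d M) :
    LinearMap.adjoint (bondJump l l' 3) =
      num up l' * (num up l * (fDag down l' * f down l + fDag down l * f down l')) := by
  simp only [bondJump_three, adjoint_mul, map_add, adjoint_fDag, adjoint_f, adjoint_num]

theorem pairSum_insert_eq (N : ℕ) (B : Finset (Site d M)) (l : Site d M) :
    pairSum N (insert l B) =
      ∑ A with A.card = N, if B ⊆ A ∧ l ∈ A then pairKet A else 0 := by
  rw [pairSum, Finset.sum_filter, Finset.sum_filter]
  refine Finset.sum_congr rfl fun A _ => ?_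
  by_cases h1 : A.card = N <;> by_cases h2 : B ⊆ A <;> by_cases h3 : l ∈ A <;>
    simp [h1, h2, h3, Finset.insert_subset_iff]

theorem subset_siteSwap {l l' : Site d M} {B : Finset (Site d M)} (h : l ∉ B) (h' : l' ∉ B)
    (A : Finset (Site d M)) : B ⊆ siteSwap l l' A ↔ B ⊆ A := by
  refine forall₂_congr fun x hx => ?_
  rw [mem_siteSwap, Equiv.swap_apply_of_ne_of_ne] <;> rintro rfl <;> contradiction

/-- Since `B` avoids both sites, the exchange permutes the sets containing `B`. Each term is
`occDiff` times a difference of two signed states; as `occDiff` is odd, both halves have the same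
sum, whence the factor `2`. -/
theorem adjoint_bondJump_zero_pairSum {l l' : Site d M} (hne : l ≠ l')
    (hs : checkerboard l' = -checkerboard l) {B : Finset (Site d M)} (h : l ∉ B) (h' : l' ∉ B)
    (N : ℕ) :
    LinearMap.adjoint (bondJump l l' 0) (pairSum N B) =
      (2 : ℂ) • (pairSum N (insert l B) - pairSum N (insert l' B)) := by
  have h1 : pairSum N B = ∑ A with A.card = N, if B ⊆ A then pairKet A else 0 := by
    rw [pairSum, ← Finset.sum_filter, Finset.filter_filter]
  have h2 := sum_card_siteSwap l l' N
    (fun A => if B ⊆ A then occDiff l l' A • pairKet A else 0)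
  rw [pairSum_insert_eq, pairSum_insert_eq, h1, map_sum, ← Finset.sum_sub_distrib]
  have h3 : ∀ A : Finset (Site d M),
      LinearMap.adjoint (bondJump l l' 0) (if B ⊆ A then pairKet A else 0) =
      (if B ⊆ A then occDiff l l' A • pairKet A else 0) +
      (if B ⊆ siteSwap l l' A then
        occDiff l l' (siteSwap l l' A) • pairKet (siteSwap l l' A) else 0) := by
    intro A
    simp only [subset_siteSwap h h']
    split_ifs with hA
    · rw [adjoint_bondJump_zero, pairDag_add_apply_pair_sub hne hs, occDiff_siteSwap]
      module
    · simp
  have h4 : ∀ A : Finset (Site d M),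
      ((if B ⊆ A ∧ l ∈ A then pairKet A else 0) - if B ⊆ A ∧ l' ∈ A then pairKet A else 0) =
      if B ⊆ A then occDiff l l' A • pairKet A else 0 := by
    intro A
    by_cases hA : B ⊆ A <;> by_cases hl : l ∈ A <;> by_cases hl' : l' ∈ A <;>
      simp [occDiff, hA, hl, hl']
  simp only [h3, h4]
  rw [Finset.sum_add_distrib, h2, two_smul]

/-- Double counting: each `A ⊇ B` with `N` elements occurs once for every element of `A \ B`. -/
theorem sum_pairSum_insert (N : ℕ) (B : Finset (Site d M)) :
    ∑ l with l ∉ B, pairSum N (insert l B) = ((N : ℂ) - B.card) • pairSum N B := by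
  have h1 : pairSum N B = ∑ A with A.card = N, if B ⊆ A then pairKet A else 0 := by
    rw [pairSum, ← Finset.sum_filter, Finset.filter_filter]
  simp only [pairSum_insert_eq]
  rw [Finset.sum_comm, h1, Finset.smul_sum]
  refine Finset.sum_congr rfl fun A hA => ?_
  split_ifs with hB
  · simp only [hB, true_and]
    rw [← Finset.sum_filter, Finset.sum_const, Finset.filter_filter]
    have : (Finset.univ.filter fun l => l ∉ B ∧ l ∈ A) = A \ B := by
      ext l
      simp [and_comm]
    rw [this, Finset.card_sdiff_of_subset hB, ← Nat.cast_smul_eq_nsmul ℂ,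
      Nat.cast_sub (Finset.card_le_card hB), (Finset.mem_filter.1 hA).2]
  · simp [hB]

/-- If exchanging an element of a set for an adjacent one does not change a function modulo `W`,
then the same holds for connected elements. -/
theorem sub_mem_of_reflTransGen {V E : Type*} [DecidableEq V] [AddCommGroup E] [Module ℂ E]
    (W : Submodule ℂ E) (F : Finset V → E) (r : V → V → Prop) (n : ℕ)
    (hr : ∀ a b, r a b → ∀ B : Finset V, B.card = n → a ∉ B → b ∉ B →
      F (insert a B) - F (insert b B) ∈ W) {a b : V} (h : Relation.ReflTransGen r a b) :
    ∀ B : Finset V, B.card = n → a ∉ B → b ∉ B → F (insert a B) - F (insert b B) ∈ W := by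
  induction h using Relation.ReflTransGen.head_induction_on with
  | refl => simp
  | @head a c hac _ ih =>
    intro B hB ha hb
    -- If the intermediate element `c` is already in the set, the moves are made in the other order:
    -- first `c` goes to `b`, then `a` takes the place of `c`.
    by_cases hc : c ∈ B
    · by_cases hab : a = b
      · simp [hab]
      · obtain ⟨B, hcB, rfl⟩ : ∃ B', c ∉ B' ∧ insert c B' = B :=
          ⟨B.erase c, Finset.notMem_erase c B, Finset.insert_erase hc⟩
        rw [Finset.card_insert_of_notMem hcB] at hB
        simp only [Finset.mem_insert, not_or] at ha hb
        have h1 := ih (insert a B)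
          (by rw [Finset.card_insert_of_notMem ha.2, hB])
          (by simp [Ne.symm ha.1, hcB]) (by simp [Ne.symm hab, hb.2])
        have h2 := hr a c hac (insert b B)
          (by rw [Finset.card_insert_of_notMem hb.2, hB])
          (by simp [hab, ha.2]) (by simp [Ne.symm hb.1, hcB])
        have := W.add_mem h1 h2
        rw [Finset.insert_comm a c, Finset.insert_comm b c, Finset.insert_comm a b] at *
        simpa using this
    · have := W.add_mem (hr a c hac B hB ha hc) (ih B hB hc hb)
      simpa using this

/-- Induction on the number of marked sites. For fixed `B`, all differences of the vectors `pairSum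
N (insert l B)` lie in `W`, and so does their sum over `l ∉ B`, a multiple of `pairSum N B`; hence
so does each of them. -/
theorem AdjointInvariant.pairSum_mem [NeZero M] {W : Submodule ℂ (Fock d M)}
    (hW : AdjointInvariant W) (hM : Even M) {N : ℕ} (hη : pairSum N ∅ ∈ W) :
    ∀ n (B : Finset (Site d M)), B.card = n → pairSum N B ∈ W := by
  intro n
  induction n with
  | zero =>
    intro B hB
    rwa [Finset.card_eq_zero.1 hB]
  | succ n ih =>
    intro A hA
    have hadj : ∀ a b : Site d M, Adj a b → ∀ B : Finset (Site d M), B.card = n → a ∉ B → b ∉ B →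
        pairSum N (insert a B) - pairSum N (insert b B) ∈ W := by
      intro a b hab B hB ha hb
      have hs : checkerboard b = -checkerboard a := by
        rcases hab with ⟨k, rfl⟩ | ⟨k, rfl⟩
        · exact checkerboard_next hM a k
        · rw [checkerboard_next hM, neg_neg]
      have h1 := hW.bondJump_mem hab 0 (ih B hB)
      rw [adjoint_bondJump_zero_pairSum (hab.ne hM) hs ha hb] at h1
      exact (W.smul_mem_iff two_ne_zero).1 h1
    have hconn : ∀ a b : Site d M, ∀ B : Finset (Site d M), B.card = n → a ∉ B → b ∉ B →
        pairSum N (insert a B) - pairSum N (insert b B) ∈ W := fun a b =>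
      sub_mem_of_reflTransGen W (pairSum N) Adj n hadj (reflTransGen_adj a b)
    obtain ⟨a, ha⟩ : A.Nonempty := Finset.card_pos.1 (by omega)
    obtain ⟨B, haB, rfl⟩ : ∃ B, a ∉ B ∧ insert a B = A :=
      ⟨A.erase a, Finset.notMem_erase a A, Finset.insert_erase ha⟩
    have hB : B.card = n := by
      rw [Finset.card_insert_of_notMem haB] at hA
      omega
    have h1 : ∑ l with l ∉ B, pairSum N (insert l B) ∈ W := by
      rw [sum_pairSum_insert]
      exact W.smul_mem _ (ih B hB)
    -- Adding the total to these differences leaves the vector for `a` times the number of sites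
    -- outside `B`, which is positive because `a` is one of them.
    have h2 : ∑ l with l ∉ B, (pairSum N (insert a B) - pairSum N (insert l B)) ∈ W :=
      W.sum_mem fun l hl => hconn a l B hB haB (Finset.mem_filter.1 hl).2
    have h3 := W.add_mem h2 h1
    rw [← Finset.sum_add_distrib] at h3
    simp only [sub_add_cancel, Finset.sum_const] at h3
    rw [← Nat.cast_smul_eq_nsmul ℂ] at h3
    refine (W.smul_mem_iff ?_).1 h3
    have : a ∈ Finset.univ.filter fun l => l ∉ B := by simp [haB]
    exact_mod_cast (Finset.card_pos.2 ⟨a, this⟩).ne'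

theorem AdjointInvariant.ket_fullModes_mem [NeZero M] {W : Submodule ℂ (Fock d M)}
    (hW : AdjointInvariant W) (hM : Even M) {N : ℕ} (hη : pairSum N ∅ ∈ W)
    {A : Finset (Site d M)} (hA : A.card = N) : ket (fullModes A) ∈ W := by
  have h1 := hW.pairSum_mem hM hη N A hA
  have h2 : (Finset.univ.filter fun B : Finset (Site d M) => B.card = N ∧ A ⊆ B) = {A} := by
    ext B
    simp only [Finset.mem_filter, Finset.mem_univ, true_and, Finset.mem_singleton]
    constructor
    · rintro ⟨h, h'⟩
      exact (Finset.eq_of_subset_of_card_le h' (by omega)).symm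
    · rintro rfl
      exact ⟨hA, Finset.Subset.refl _⟩
  rw [pairSum, h2, Finset.sum_singleton, pairKet] at h1
  exact (W.smul_mem_iff (Finset.prod_ne_zero_iff.2 fun l _ => checkerboard_ne_zero l)).1 h1

/-! ### Adjoint jumps generate the broken pairs. -/

/-- The sites occupied by a fermion with internal state `σ`. -/
def occSites (σ : Spin) (S : Finset (Mode d M)) : Finset (Site d M) :=
  Finset.univ.filter fun l => (l, σ) ∈ S

@[simp] theorem mem_occSites (σ : Spin) (S : Finset (Mode d M)) (l : Site d M) :
    l ∈ occSites σ S ↔ (l, σ) ∈ S := by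
  simp [occSites]

theorem card_occSites (σ : Spin) (S : Finset (Mode d M)) :
    (occSites σ S).card = (S.filter fun m => m.2 = σ).card := by
  have : (S.filter fun m => m.2 = σ) = (occSites σ S).image fun l => (l, σ) := by
    ext ⟨l, τ⟩
    simp only [Finset.mem_filter, Finset.mem_image, mem_occSites, Prod.mk.injEq]
    constructor
    · rintro ⟨h, rfl⟩
      exact ⟨l, h, rfl, rfl⟩
    · rintro ⟨x, h, rfl, rfl⟩
      exact ⟨h, rfl⟩
  rw [this, Finset.card_image_of_injective _ (Prod.mk_left_injective σ)]

theorem isBalanced_iff {N : ℕ} {S : Finset (Mode d M)} :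
    IsBalanced N S ↔ (occSites up S).card = N ∧ (occSites down S).card = N := by
  rw [card_occSites, card_occSites, IsBalanced]

theorem card_filter_insert_erase {m m' : Mode d M} {S : Finset (Mode d M)} (h : m ∈ S)
    (h' : m' ∉ S) (e : m'.2 = m.2) (σ : Spin) :
    ((insert m' (S.erase m)).filter fun k => k.2 = σ).card =
      (S.filter fun k => k.2 = σ).card := by
  have hm' : m' ∉ S.erase m := fun e => h' (Finset.mem_of_mem_erase e)
  have h1 : ((insert m (S.erase m)).filter fun k => k.2 = σ).card =
      (S.filter fun k => k.2 = σ).card := by rw [Finset.insert_erase h]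
  rw [← h1, Finset.filter_insert, Finset.filter_insert, e]
  split_ifs
  · rw [Finset.card_insert_of_notMem (by simp [hm']), Finset.card_insert_of_notMem (by simp)]
  · rfl

theorem IsBalanced.insert_erase {N : ℕ} {m m' : Mode d M} {S : Finset (Mode d M)}
    (hS : IsBalanced N S) (h : m ∈ S) (h' : m' ∉ S) (e : m'.2 = m.2) :
    IsBalanced N (insert m' (S.erase m)) :=
  ⟨by rw [card_filter_insert_erase h h' e, hS.1], by rw [card_filter_insert_erase h h' e, hS.2]⟩

/-- The sites occupied by a single fermion, which has spin up. -/
def upSingles (S : Finset (Mode d M)) : Finset (Site d M) := occSites up S \ occSites down S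

theorem mem_upSingles {S : Finset (Mode d M)} {l : Site d M} :
    l ∈ upSingles S ↔ (l, up) ∈ S ∧ (l, down) ∉ S := by
  simp [upSingles]

theorem eq_fullModes_of_upSingles_eq_empty {N : ℕ} {S : Finset (Mode d M)}
    (hS : IsBalanced N S) (h : upSingles S = ∅) : S = fullModes (occSites up S) := by
  rw [isBalanced_iff] at hS
  have h1 : occSites up S = occSites down S :=
    Finset.eq_of_subset_of_card_le (Finset.sdiff_eq_empty_iff_subset.1 h) (by omega)
  ext ⟨l, σ⟩
  rw [mem_fullModes]
  fin_cases σ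
  · exact (mem_occSites up S l).symm
  · rw [h1]
    exact (mem_occSites down S l).symm

/-- Equal numbers of both spins force as many spin-down singles as spin-up singles. -/
theorem exists_down_single {N : ℕ} {S : Finset (Mode d M)} (hS : IsBalanced N S)
    (h : (upSingles S).Nonempty) : ∃ b : Site d M, (b, down) ∈ S ∧ (b, up) ∉ S := by
  rw [isBalanced_iff] at hS
  have h1 : (occSites down S \ occSites up S).card = (upSingles S).card :=
    Finset.card_sdiff_comm (by omega)
  obtain ⟨b, hb⟩ := Finset.card_pos.1 (h1 ▸ Finset.card_pos.2 h)
  exact ⟨b, by simpa using hb⟩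

theorem exists_create_ann_ket_hop {m m' : Mode d M} {S : Finset (Mode d M)} (h : m ∈ S)
    (h' : m' ∉ S) :
    ∃ ε : ℂ, ε ≠ 0 ∧ create m (ann m' (ket (insert m' (S.erase m)))) = ε • ket S := by
  have hne : m ≠ m' := fun e => h' (e ▸ h)
  have hm' : m' ∉ S.erase m := fun e => h' (Finset.mem_of_mem_erase e)
  obtain ⟨ε, h0, hε⟩ := exists_create_ann_ket (m := m') (m' := m) (S := insert m' (S.erase m))
    (Finset.mem_insert_self _ _) (by simp [hne])
  rw [Finset.erase_insert hm', Finset.insert_erase h] at hε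
  exact ⟨ε, h0, hε⟩

/-- The spin-up single at `a` is traced along a path to the spin-down single at `b`. According to
the occupation of the next site `c`, the state is obtained by an adjoint jump from one whose spin-up
single is already at `c`, or from one with fewer spin-up singles. -/
theorem AdjointInvariant.ket_mem_of_path [NeZero M] {W : Submodule ℂ (Fock d M)}
    (hW : AdjointInvariant W) (hM : Even M) {N n : ℕ}
    (hn : ∀ S, IsBalanced N S → (upSingles S).card ≤ n → ket S ∈ W) {a b : Site d M}
    (h : Relation.ReflTransGen Adj a b) :
    ∀ S, IsBalanced N S → (upSingles S).card ≤ n + 1 → (a, up) ∈ S → (a, down) ∉ S →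
      (b, down) ∈ S → (b, up) ∉ S → ket S ∈ W := by
  induction h using Relation.ReflTransGen.head_induction_on with
  | refl =>
    intro S _ _ _ h1 h2 _
    exact absurd h2 h1
  | @head a c hac _ ih =>
    intro S hS hcard hau had hbd hbu
    have hne : a ≠ c := hac.ne hM
    have hba : b ≠ a := fun e => hbu (e ▸ hau)
    have ha : a ∈ upSingles S := mem_upSingles.2 ⟨hau, had⟩
    have hcard1 : ∀ T, upSingles T ⊆ insert c ((upSingles S).erase a) →
        (upSingles T).card ≤ n + 1 := by
      intro T hT
      have h1 := Finset.card_le_card hT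
      have h2 := Finset.card_insert_le c ((upSingles S).erase a)
      have h3 := Finset.card_erase_add_one ha
      omega
    by_cases hcu : (c, up) ∈ S <;> by_cases hcd : (c, down) ∈ S
    -- Site `c` carries a pair: in the predecessor pair and single are interchanged, and the adjoint
    -- of family `3` interchanges them back.
    · have hbc : b ≠ c := fun e => hbu (e ▸ hcu)
      have hmem : ket (insert (a, down) (S.erase (c, down))) ∈ W := by
        refine ih _ (hS.insert_erase hcd had rfl) (hcard1 _ ?_) ?_ ?_ ?_ ?_
        · intro l hl
          rw [mem_upSingles] at hl
          by_cases hlc : l = c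
          · simp [hlc]
          · have hla : l ≠ a := by
              rintro rfl
              exact hl.2 (Finset.mem_insert_self _ _)
            simpa [hlc, hla, mem_upSingles] using hl
        · simp [hcu]
        · simp [hne.symm]
        · simp [hbc, hbd]
        · simp [hbu]
      have h1 := hW.bondJump_mem hac 3 hmem
      obtain ⟨ε, h0, hε⟩ := exists_create_ann_ket_hop hcd had
      rw [adjoint_bondJump_three] at h1
      simp only [Module.End.mul_apply, LinearMap.add_apply, fDag_eq_create, f_eq_ann] at h1
      rw [hε, ann_ket_of_notMem (m := (c, down)) (by simp [hne.symm]), map_zero, add_zero,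
        map_smul, num_ket, if_pos hau, map_smul, num_ket, if_pos hcu] at h1
      exact (W.smul_mem_iff h0).1 h1
    -- Site `c` is itself a spin-up single, so the path may start there without any jump.
    · exact ih S hS hcard hcu hcd hbd hbu
    -- Site `c` is a spin-down single: the predecessor has a pair on `a` and nothing on `c`, hence
    -- one spin-up single fewer, and the adjoint of family `1` breaks that pair.
    · have hmem : ket (insert (a, down) (S.erase (c, down))) ∈ W := by
        refine hn _ (hS.insert_erase hcd had rfl) ?_
        have h1 : upSingles (insert (a, down) (S.erase (c, down))) ⊆ (upSingles S).erase a := by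
          intro l hl
          rw [mem_upSingles] at hl
          have hla : l ≠ a := by
            rintro rfl
            exact hl.2 (Finset.mem_insert_self _ _)
          have hlc : l ≠ c := by
            rintro rfl
            simp [hcu] at hl
          simpa [hlc, hla, mem_upSingles] using hl
        have h2 := Finset.card_le_card h1
        have h3 := Finset.card_erase_add_one ha
        omega
      have h1 := hW.bondJump_mem hac 1 hmem
      obtain ⟨ε, h0, hε⟩ := exists_create_ann_ket_hop hcd had
      rw [adjoint_bondJump_one] at h1
      simp only [Module.End.mul_apply, LinearMap.add_apply, fDag_eq_create, f_eq_ann] at h1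
      rw [num_ket, num_ket, if_pos (by simp [hau]), if_neg (by simp [hcu]), hε, map_zero,
        map_zero, add_zero] at h1
      exact (W.smul_mem_iff h0).1 h1
    -- Site `c` is empty: the predecessor has the single on `c`. The adjoint of family `2` produces
    -- a nonzero multiple of the wanted state plus the predecessor, which is already in `W`.
    · have hbc : b ≠ c := fun e => hcd (e ▸ hbd)
      have hmem : ket (insert (c, up) (S.erase (a, up))) ∈ W := by
        refine ih _ (hS.insert_erase hau hcu rfl) (hcard1 _ ?_) ?_ ?_ ?_ ?_
        · intro l hl
          rw [mem_upSingles] at hl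
          by_cases hlc : l = c
          · simp [hlc]
          · have hla : l ≠ a := by
              rintro rfl
              simp [hlc] at hl
            simpa [hlc, hla, mem_upSingles] using hl
        · simp
        · simp [hcd]
        · simp [hbd]
        · simp [hbc, hbu]
      have h1 := hW.bondJump_mem hac 2 hmem
      obtain ⟨ε, h0, hε⟩ := exists_create_ann_ket_hop hau hcu
      have hself : create (c, up) (ann (c, up) (ket (insert (c, up) (S.erase (a, up))))) =
          ket (insert (c, up) (S.erase (a, up))) := by
        rw [create_ann_ket, if_pos (Finset.mem_insert_self _ _)]
      have hnum : ∀ T : Finset (Mode d M), ∀ l : Site d M, (l, down) ∉ T →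
          (1 - num down l) (ket T) = ket T := by
        intro T l hl
        rw [LinearMap.sub_apply, num_ket, if_neg hl, sub_zero, Module.End.one_apply]
      rw [adjoint_bondJump_two] at h1
      rw [Module.End.mul_apply, Module.End.mul_apply, Module.End.mul_apply,
        LinearMap.add_apply (f up a), f_eq_ann, f_eq_ann,
        ann_ket_of_notMem (m := (a, up)) (by simp [hne]), zero_add, LinearMap.add_apply,
        fDag_eq_create, fDag_eq_create, hε, hself, map_add, map_add, map_smul, map_smul,
        hnum S a had, hnum S c hcd, hnum _ a (by simp [had]), hnum _ c (by simp [hcd])] at h1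
      exact (W.smul_mem_iff h0).1 ((W.add_mem_iff_left hmem).1 h1)

theorem AdjointInvariant.ket_mem [NeZero M] {W : Submodule ℂ (Fock d M)}
    (hW : AdjointInvariant W) (hM : Even M) {N : ℕ} (hη : pairSum N ∅ ∈ W) (n : ℕ) :
    ∀ S, IsBalanced N S → (upSingles S).card ≤ n → ket S ∈ W := by
  have h0 : ∀ S, IsBalanced N S → upSingles S = ∅ → ket S ∈ W := by
    intro S hS h
    rw [eq_fullModes_of_upSingles_eq_empty hS h]
    exact hW.ket_fullModes_mem hM hη (isBalanced_iff.1 hS).1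
  induction n with
  | zero => exact fun S hS h => h0 S hS (Finset.card_eq_zero.1 (by omega))
  | succ n ih =>
    intro S hS hcard
    rcases (upSingles S).eq_empty_or_nonempty with h | h
    · exact h0 S hS h
    · obtain ⟨b, hb⟩ := exists_down_single hS h
      obtain ⟨a, ha⟩ := h
      rw [mem_upSingles] at ha
      exact hW.ket_mem_of_path hM ih (reflTransGen_adj a b) S hS hcard ha.1 ha.2 hb.1 hb.2

/-! ### Uniqueness of the dark state. -/

/-- A subspace that contains the condensate and is invariant under the adjoints of the jump
operators contains all states with the same particle numbers. -/
theorem AdjointInvariant.sector_le [NeZero M] {W : Submodule ℂ (Fock d M)}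
    (hW : AdjointInvariant W) (hM : Even M) {N : ℕ} (hη : etaCondensate d M N ∈ W) :
    sector d M N ≤ W := by
  intro ψ hψ
  rw [etaCondensate_eq] at hη
  have hη' := (W.smul_mem_iff (etaCondensate_coeff_ne_zero N)).1 hη
  rw [eq_sum_ket ψ]
  refine W.sum_mem fun S _ => ?_
  by_cases hS : IsBalanced N S
  · exact W.smul_mem _ (hW.ket_mem hM hη' _ S hS le_rfl)
  · rw [hψ S hS, zero_smul]
    exact W.zero_mem

theorem exists_eq_smul_of_dark [NeZero M] (hM : Even M) {N : ℕ} (hN : N ≤ M ^ d) {ψ : Fock d M}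
    (hψ : ψ ∈ sector d M N) (h : ∀ j : JumpIndex d M, jump j ψ = 0) :
    ∃ a : ℂ, ψ = a • etaCondensate d M N := by
  set φ := etaCondensate d M N with hφ
  have hφ0 : inner ℂ φ φ ≠ 0 := inner_self_ne_zero.2 (etaCondensate_ne_zero hN)
  refine ⟨inner ℂ φ ψ / inner ℂ φ φ, ?_⟩
  set χ := ψ - (inner ℂ φ ψ / inner ℂ φ φ) • φ with hχ
  have hdark : ∀ j : JumpIndex d M, jump j χ = 0 := by
    intro j
    rw [hχ, map_sub, map_smul, h j, hφ, jump_etaCondensate hM]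
    simp
  -- Darkness of `χ` gives `⟨χ, c†w⟩ = ⟨cχ, w⟩ = 0`.
  have hW : AdjointInvariant (Submodule.span ℂ {χ})ᗮ := by
    intro j w _
    rw [Submodule.mem_orthogonal_singleton_iff_inner_right, LinearMap.adjoint_inner_right, hdark j,
      inner_zero_left]
  have hη : φ ∈ (Submodule.span ℂ {χ})ᗮ := by
    rw [Submodule.mem_orthogonal_singleton_iff_inner_left, hχ, inner_sub_right, inner_smul_right,
      div_mul_cancel₀ _ hφ0, sub_self]
  have hmem : χ ∈ sector d M N :=
    Submodule.sub_mem _ hψ (Submodule.smul_mem _ _ (etaCondensate_mem_sector N))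
  have := hW.sector_le hM hη hmem
  rw [Submodule.mem_orthogonal_singleton_iff_inner_right, inner_self_eq_zero] at this
  exact sub_eq_zero.1 this

/-! ### Uniqueness of the stationary state. -/

/-- Written as a sum of rank-one operators, `ρ` has expectation `∑ |⟨u i, x⟩|²`, so every overlap
vanishes. -/
theorem IsPositive.apply_eq_zero {E : Type*} [NormedAddCommGroup E] [InnerProductSpace ℂ E]
    [FiniteDimensional ℂ E] {ρ : E →ₗ[ℂ] E} (hρ : ρ.IsPositive) {x : E}
    (h : inner ℂ x (ρ x) = 0) : ρ x = 0 := by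
  obtain ⟨m, u, hu⟩ := ContinuousLinearMap.isPositive_iff_eq_sum_rankOne.1
    ((LinearMap.isPositive_toContinuousLinearMap_iff ρ).2 hρ)
  have h1 : ∀ y, ρ y = ∑ i, inner ℂ (u i) y • u i := by
    intro y
    have := congrArg (fun T : E →L[ℂ] E => T y) hu
    simpa using this
  rw [h1, inner_sum] at h
  have h2 : ∀ i, inner ℂ x (inner ℂ (u i) x • u i) = ((‖inner ℂ (u i) x‖ ^ 2 : ℝ) : ℂ) := by
    intro i
    rw [inner_smul_right, ← inner_conj_symm x (u i), Complex.mul_conj, Complex.normSq_eq_norm_sq]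
  simp only [h2] at h
  rw [← Complex.ofReal_sum, Complex.ofReal_eq_zero,
    Finset.sum_eq_zero_iff_of_nonneg fun i _ => sq_nonneg _] at h
  rw [h1]
  refine Finset.sum_eq_zero fun i hi => ?_
  have := h i hi
  rw [sq_eq_zero_iff, norm_eq_zero] at this
  rw [this, zero_smul]

theorem adjoint_hop (l l' : Site d M) : LinearMap.adjoint (hop l l') = hop l l' := by
  rw [hop, map_sum]
  refine Finset.sum_congr rfl fun σ _ => ?_
  rw [map_add, adjoint_mul, adjoint_mul, adjoint_fDag, adjoint_fDag, adjoint_f, adjoint_f,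
    add_comm]

theorem adjoint_real_smul (a : ℝ) (X : Fock d M →ₗ[ℂ] Fock d M) :
    LinearMap.adjoint ((a : ℂ) • X) = (a : ℂ) • LinearMap.adjoint X := by
  rw [map_smulₛₗ, Complex.conj_ofReal]

theorem adjoint_hubbard [NeZero M] (J U : ℝ) :
    LinearMap.adjoint (hubbard d M J U) = hubbard d M J U := by
  have h2 : ∀ l : Site d M,
      LinearMap.adjoint (num up l * num down l) = num up l * num down l := by
    intro l
    rw [adjoint_mul, adjoint_num, adjoint_num, (num_commute _ _ _ _).eq]
  rw [hubbard_eq, map_add, neg_smul, map_neg, adjoint_real_smul, adjoint_real_smul, map_sum,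
    map_sum]
  simp only [map_sum, adjoint_hop, h2]

open scoped ComplexOrder in
-- The hypotheses on `v` remove the commutator and anticommutator terms from the expectation of the
-- stationarity equation. What remains is a sum of nonnegative terms `2 g ⟨c†v, ρ c†v⟩` equal to
-- zero, and positivity of `ρ` upgrades vanishing expectation to `ρ c†v = 0`.
theorem apply_adjoint_eq_zero_of_stationary {ι : Type*} [Fintype ι]
    {H ρ : Fock d M →ₗ[ℂ] Fock d M} {c : ι → (Fock d M →ₗ[ℂ] Fock d M)} {g : ι → ℝ}
    (hg : ∀ j, 0 < g j) (hρ : ρ.IsPositive) (hL : liouvillian H c g ρ = 0) {v : Fock d M}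
    (hH : inner ℂ v ((H * ρ - ρ * H) v) = 0)
    (h1 : ∀ j, inner ℂ v ((LinearMap.adjoint (c j) * c j * ρ) v) = 0)
    (h2 : ∀ j, inner ℂ v ((ρ * (LinearMap.adjoint (c j) * c j)) v) = 0) (j : ι) :
    ρ (LinearMap.adjoint (c j) v) = 0 := by
  have h3 : inner ℂ v (liouvillian H c g ρ v) = 0 := by
    rw [hL, LinearMap.zero_apply, inner_zero_right]
  rw [liouvillian, LinearMap.add_apply, LinearMap.smul_apply, inner_add_right, inner_smul_right,
    hH, mul_zero, zero_add, LinearMap.sum_apply, inner_sum] at h3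
  have h4 : ∀ j, inner ℂ v (((g j : ℂ) • ((2 : ℂ) • (c j * ρ * LinearMap.adjoint (c j))
      - LinearMap.adjoint (c j) * c j * ρ - ρ * (LinearMap.adjoint (c j) * c j))) v) =
      (g j : ℂ) * (2 * inner ℂ (LinearMap.adjoint (c j) v) (ρ (LinearMap.adjoint (c j) v))) := by
    intro j
    rw [LinearMap.smul_apply, inner_smul_right, LinearMap.sub_apply, LinearMap.sub_apply,
      inner_sub_right, inner_sub_right, h1, h2, sub_zero, sub_zero, LinearMap.smul_apply,
      inner_smul_right, Module.End.mul_apply, Module.End.mul_apply, LinearMap.adjoint_inner_left]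
  simp only [h4] at h3
  have h5 : ∀ j ∈ Finset.univ, (0 : ℂ) ≤
      (g j : ℂ) * (2 * inner ℂ (LinearMap.adjoint (c j) v) (ρ (LinearMap.adjoint (c j) v))) := by
    intro j _
    have h6 : (0 : ℂ) ≤ (g j : ℂ) := by exact_mod_cast (hg j).le
    exact mul_nonneg h6 (mul_nonneg zero_le_two (hρ.inner_nonneg_right _))
  have h7 := (Finset.sum_eq_zero_iff_of_nonneg h5).1 h3 j (Finset.mem_univ j)
  have h8 : (g j : ℂ) ≠ 0 := by exact_mod_cast (hg j).ne'
  exact IsPositive.apply_eq_zero hρ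
    (((mul_eq_zero.1 h7).resolve_left h8 |> mul_eq_zero.1).resolve_left two_ne_zero)

theorem lineProjection_apply (φ ψ : Fock d M) :
    lineProjection φ ψ = (((‖φ‖ : ℂ) ^ 2)⁻¹ * inner ℂ φ ψ) • φ := by
  simp [lineProjection, smul_smul]

theorem trace_lineProjection {φ : Fock d M} (hφ : φ ≠ 0) :
    LinearMap.trace ℂ (Fock d M) (lineProjection φ) = 1 := by
  rw [lineProjection, map_smul, InnerProductSpace.trace_rankOne, inner_self_eq_norm_sq_to_K,
    smul_eq_mul]
  refine inv_mul_cancel₀ (pow_ne_zero _ ?_)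
  exact_mod_cast norm_ne_zero_iff.2 hφ

theorem isDensityOperator_lineProjection {N : ℕ} {φ : Fock d M} (hφ : φ ≠ 0)
    (h : φ ∈ sector d M N) : IsDensityOperator N (lineProjection φ) where
  isPositive := by
    refine LinearMap.IsPositive.smul_of_nonneg ?_ ?_
    · exact (ContinuousLinearMap.isPositive_toLinearMap_iff _).2
        (InnerProductSpace.isPositive_rankOne_self φ)
    · rw [← Complex.ofReal_pow, ← Complex.ofReal_inv]
      exact_mod_cast inv_nonneg.2 (sq_nonneg ‖φ‖)
  trace_eq_one := trace_lineProjection hφ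
  range_le := by
    rintro _ ⟨ψ, rfl⟩
    rw [lineProjection_apply]
    exact Submodule.smul_mem _ _ h

theorem liouvillian_lineProjection {ι : Type*} [Fintype ι] {H : Fock d M →ₗ[ℂ] Fock d M}
    {c : ι → (Fock d M →ₗ[ℂ] Fock d M)} (g : ι → ℝ) {φ : Fock d M} {E : ℝ}
    (hH : LinearMap.adjoint H = H) (hφ : H φ = (E : ℂ) • φ) (hc : ∀ j, c j φ = 0) :
    liouvillian H c g (lineProjection φ) = 0 := by
  have h1 : H * lineProjection φ - lineProjection φ * H = 0 := by
    ext1 ψ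
    have : inner ℂ φ (H ψ) = (E : ℂ) * inner ℂ φ ψ := by
      rw [← LinearMap.adjoint_inner_left, hH, hφ, inner_smul_left, Complex.conj_ofReal]
    rw [LinearMap.sub_apply, Module.End.mul_apply, Module.End.mul_apply, lineProjection_apply,
      lineProjection_apply, map_smul, hφ, this, LinearMap.zero_apply]
    module
  have h2 : ∀ j, c j * lineProjection φ = 0 := by
    intro j
    ext1 ψ
    rw [Module.End.mul_apply, lineProjection_apply, map_smul, hc j, smul_zero,
      LinearMap.zero_apply]
  have h3 : ∀ j, lineProjection φ * (LinearMap.adjoint (c j) * c j) = 0 := by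
    intro j
    ext1 ψ
    rw [Module.End.mul_apply, lineProjection_apply, Module.End.mul_apply,
      LinearMap.adjoint_inner_right, hc j, inner_zero_left, mul_zero, zero_smul,
      LinearMap.zero_apply]
  simp [liouvillian, h1, h2, h3, mul_assoc]

theorem apply_eq_zero_of_orthogonal {ρ : Fock d M →ₗ[ℂ] Fock d M} (hρ : ρ.IsPositive)
    {K : Submodule ℂ (Fock d M)} (hK : LinearMap.range ρ ≤ K) {w : Fock d M} (hw : w ∈ Kᗮ) :
    ρ w = 0 := by
  rw [← inner_self_eq_zero (𝕜 := ℂ), hρ.isSymmetric]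
  exact Submodule.inner_left_of_mem_orthogonal (hK ⟨_, rfl⟩) hw

theorem eq_lineProjection_of_stationary [NeZero M] (hM : Even M) {N : ℕ} (hN : N ≤ M ^ d)
    (J U : ℝ) {g : JumpIndex d M → ℝ} (hg : ∀ j, 0 < g j) {ρ : Fock d M →ₗ[ℂ] Fock d M}
    (hρ : IsDensityOperator N ρ) (hL : liouvillian (hubbard d M J U) jump g ρ = 0) :
    ρ = lineProjection (etaCondensate d M N) := by
  set φ := etaCondensate d M N with hφ
  have hpos := hρ.isPositive
  have hφ0 : φ ≠ 0 := etaCondensate_ne_zero hN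
  have hc : ∀ j : JumpIndex d M, jump j φ = 0 := fun j => jump_etaCondensate hM j N
  have hker : ∀ v, ρ v = 0 → ∀ j : JumpIndex d M, ρ (LinearMap.adjoint (jump j) v) = 0 := by
    intro v hv
    have hv' : ∀ w, inner ℂ v (ρ w) = 0 := by
      intro w
      rw [← hpos.isSymmetric, hv, inner_zero_left]
    refine apply_adjoint_eq_zero_of_stationary hg hpos hL ?_ ?_ ?_
    · rw [LinearMap.sub_apply, Module.End.mul_apply, Module.End.mul_apply, hv, map_zero, zero_sub,
        inner_neg_right, hv', neg_zero]
    · intro j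
      rw [Module.End.mul_apply, hv, map_zero, inner_zero_right]
    · intro j
      rw [Module.End.mul_apply, hv']
  have hφker : ∀ j : JumpIndex d M, ρ (LinearMap.adjoint (jump j) φ) = 0 := by
    have hE : hubbard d M J U φ = (((N : ℝ) * U : ℝ) : ℂ) • φ := by
      rw [hφ, hubbard_etaCondensate hM]
      push_cast
      rfl
    refine apply_adjoint_eq_zero_of_stationary hg hpos hL ?_ ?_ ?_
    · rw [LinearMap.sub_apply, Module.End.mul_apply, Module.End.mul_apply, inner_sub_right,
        ← LinearMap.adjoint_inner_left, adjoint_hubbard, hE, map_smul, inner_smul_left,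
        inner_smul_right, Complex.conj_ofReal, sub_self]
    · intro j
      rw [mul_assoc, Module.End.mul_apply, LinearMap.adjoint_inner_right, hc, inner_zero_left]
    · intro j
      rw [Module.End.mul_apply, Module.End.mul_apply, hc, map_zero, map_zero, inner_zero_right]
  -- The condensate is adjoined to the kernel so that `sector_le` applies; adjoint jumps even send
  -- this sum back into the kernel.
  set W := LinearMap.ker ρ ⊔ Submodule.span ℂ {φ} with hWdef
  have hWker : ∀ w ∈ W, ∀ j : JumpIndex d M, ρ (LinearMap.adjoint (jump j) w) = 0 := by
    intro w hw j
    obtain ⟨k, hk, x, hx, rfl⟩ := Submodule.mem_sup.1 hw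
    obtain ⟨a, rfl⟩ := Submodule.mem_span_singleton.1 hx
    rw [map_add, map_smul, map_add, map_smul, hker k hk j, hφker j, smul_zero, add_zero]
  have hWinv : AdjointInvariant W := fun j w hw =>
    Submodule.mem_sup_left (LinearMap.mem_ker.2 (hWker w hw j))
  have hsec : sector d M N ≤ W :=
    hWinv.sector_le hM (Submodule.mem_sup_right (Submodule.mem_span_singleton_self φ))
  -- The sector is contained in `W`, and its orthogonal complement is killed by `ρ`.
  have hWtop : ∀ w, w ∈ W := by
    intro w
    obtain ⟨s, hs, t, ht, rfl⟩ := (sector d M N).exists_add_mem_mem_orthogonal w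
    exact W.add_mem (hsec hs) (Submodule.mem_sup_left
      (LinearMap.mem_ker.2 (apply_eq_zero_of_orthogonal hpos hρ.range_le ht)))
  -- Taking adjoints in `ρ c† = 0` gives `c ρ = 0`, so the range of `ρ` consists of dark vectors.
  have hdark : ∀ u, ∃ a : ℂ, ρ u = a • φ := by
    intro u
    refine exists_eq_smul_of_dark hM hN (hρ.range_le ⟨u, rfl⟩) fun j => ?_
    refine ext_inner_left ℂ fun w => ?_
    rw [inner_zero_right, ← LinearMap.adjoint_inner_left, ← hpos.isSymmetric, hWker w (hWtop w) j,
      inner_zero_left]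
  have hφφ : inner ℂ φ φ ≠ 0 := inner_self_ne_zero.2 hφ0
  obtain ⟨b, hb⟩ := hdark φ
  have hform : ∃ μ : ℂ, ρ = μ • lineProjection φ := by
    -- With `ρ φ = b φ`, symmetry gives `⟨φ, ρ u⟩ = conj b ⟨φ, u⟩`, which determines `ρ u`; the
    -- factor `‖φ‖²` undoes the normalization in `lineProjection`.
    refine ⟨(‖φ‖ : ℂ) ^ 2 * ((starRingEnd ℂ) b / inner ℂ φ φ), ?_⟩
    ext1 u
    obtain ⟨a, ha⟩ := hdark u
    have h1 : inner ℂ φ (ρ u) = (starRingEnd ℂ) b * inner ℂ φ u := by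
      rw [← hpos.isSymmetric, hb, inner_smul_left]
    rw [ha, inner_smul_right] at h1
    have hn : (‖φ‖ : ℂ) ≠ 0 := by exact_mod_cast norm_ne_zero_iff.2 hφ0
    rw [ha, LinearMap.smul_apply, lineProjection_apply, smul_smul]
    congr 1
    field_simp
    exact h1
  obtain ⟨μ, hμ⟩ := hform
  have htr := hρ.trace_eq_one
  rw [hμ, map_smul, trace_lineProjection hφ0, smul_eq_mul, mul_one] at htr
  rw [hμ, htr, one_smul]

end EtaCondensate

theorem mainTheorem8 (d M N : ℕ) [NeZero M] (hd : 1 ≤ d) (hM : Even M) (hN : N ≤ M ^ d)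
    (J U : ℝ) (g : JumpIndex d M → ℝ) (hg : ∀ j, 0 < g j) :
    -- the condensate is a nonzero state of the system and an eigenstate of the Hamiltonian
    (etaCondensate d M N ≠ 0 ∧ etaCondensate d M N ∈ sector d M N ∧
      hubbard d M J U (etaCondensate d M N) = ((N : ℂ) * (U : ℂ)) • etaCondensate d M N) ∧
    -- it is the unique dark state
    (∀ ψ ∈ sector d M N,
      (∀ j : JumpIndex d M, jump j ψ = 0) ↔ ∃ a : ℂ, ψ = a • etaCondensate d M N) ∧
    -- it is the unique stationary state
    (∀ ρ : Fock d M →ₗ[ℂ] Fock d M,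
      (IsDensityOperator N ρ ∧ liouvillian (hubbard d M J U) jump g ρ = 0) ↔
        ρ = lineProjection (etaCondensate d M N)) := by
  refine ⟨⟨etaCondensate_ne_zero hN, etaCondensate_mem_sector N, hubbard_etaCondensate hM J U N⟩,
    fun ψ hψ => ⟨exists_eq_smul_of_dark hM hN hψ, ?_⟩,
    fun ρ => ⟨fun h => eq_lineProjection_of_stationary hM hN J U hg h.1 h.2, ?_⟩⟩
  · rintro ⟨a, rfl⟩ j
    rw [map_smul, jump_etaCondensate hM, smul_zero]
  · rintro rfl
    refine ⟨isDensityOperator_lineProjection (etaCondensate_ne_zero hN)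
      (etaCondensate_mem_sector N), ?_⟩
    refine liouvillian_lineProjection (E := (N : ℝ) * U) g (adjoint_hubbard J U) ?_
      fun j => jump_etaCondensate hM j N
    rw [hubbard_etaCondensate hM]
    push_cast
    rfl
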